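/- **Setting.** Let $\Omega_f\subset\mathbb R^2$ be an open fluid region lying below the free surface $\mathbb R\times\{0\}\subset\partial\Omega_f$, with $\Omega_f\cap\{|x_1|>L_0\}=\{|x_1|>L_0,\ -1<x_2<0\}$ for some $L_0>0$. Let $\Omega_o$ be a bounded open set (the obstacles, possibly empty). Put $\Omega=\Omega_f\setminus\overline{\Omega_o}$, $\Gamma_f=(\mathbb R\times\{0\})\setminus\overline{\Omega_o}$, $\Gamma_b=\partial\Omega_f\setminus(\mathbb R\times\{0\})$, $\Gamma_o=\partial\Omega_o\cap\overline{\Omega_f}$. Let $\nu>0$, let $k>0$ satisfy $k\tanh k=\nu$, and for $n\ge1$ let $\gamma_n$ satisfy $\gamma_n\tan\gamma_n=-\nu$, $n\pi-\frac\pi2<\gamma_n<n\pi$. Let $\varphi:\overline\Omega\to\mathbb C$ be a classical solution of the water-wave problem: $\varphi$ is harmonic in $\Omega$ and continuous on $\overline\Omega$; at every boundary point having a unit normal $\mathbf n$ pointing into $\Omega$, $\nabla\varphi\cdot\mathbf n$ has limits from $\Omega$ with $$\nabla\varphi\cdot\mathbf n+\nu\varphi=f_1\ \text{on }\Gamma_f,\qquad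 \nabla\varphi\cdot\mathbf n=f_2\ \text{on }\Gamma_b\cup\Gamma_o ;$$ and $\partial_{x_1}\varphi\mp ik\varphi\to0$ as $x_1\to\pm\infty$, uniformly in $x_2$. Let $L=\max\{L_1,L_2\}$, where $L_1>L_0$, $\overline{\Omega_o}\subset\{|x_1|<L_1\}$, and $f_1$, $f_2$ vanish on $\Gamma_f\cap\{|x_1|>L_2\}$ and on $\{|x_1|>L_2\}\times\{-1\}$ respectively. Let $u_0(x_2)=a_0\cosh(k(x_2+1))$, $u_n(x_2)=a_n\cos(\gamma_n(x_2+1))$ with $a_n>0$ normalizing $u_n$ in $L^2(-1,0)$, and $A_n^\pm=\int_{-1}^0\varphi(\pm L,x_2)u_n(x_2)\,dx_2$. **Conclusion.** There is a function $\varphi(z_1,x_2)$, unique on $\{|\operatorname{Re}z_1|>L\}\times[-1,0]$, which is holomorphic in $z_1$ on $\{|\operatorname{Re}z_1|>L\}$ for each $x_2\in[-1,0]$ and agrees with the solution $\varphi$ for real $z_1$. Moreover: 1. $\varphi(z_1,x_2)=A_0^+u_0(x_2)e^{ik(z_1-L)}+\sum_{n\ge1}A_n^+u_n(x_2)e^{-\gamma_n(z_1-L)}$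 locally uniformly on $\{\operatorname{Re}z_1>L\}\times[-1,0]$, and $\varphi(z_1,x_2)=A_0^-u_0(x_2)e^{-ik(z_1+L)}+\sum_{n\ge1}A_n^-u_n(x_2)e^{\gamma_n(z_1+L)}$ locally uniformly on $\{\operatorname{Re}z_1<-L\}\times[-1,0]$. 2. $\varphi(z_1,\cdot)$ is $C^2$ on $[-1,0]$ (one-sided derivatives at the end points) and $(\partial_{z_1}^2+\partial_{x_2}^2)\varphi(z_1,x_2)=0$ for $|\operatorname{Re}z_1|>L$, $x_2\in[-1,0]$. 3. Let $\tau:\mathbb R\to\mathbb C$ be continuous, differentiable off a locally finite set with $0<c<\operatorname{Re}\tau'<C$ there, $\tau(x_1)=x_1$ for $|x_1|<L$, $\operatorname{Im}\tau(x_1)>0$ for $x_1>L$ and $\operatorname{Im}\tau(x_1)<0$ for $x_1<-L$. Then $\operatorname{Re}\tau(x_1)>L$ for $x_1>L$ and $\operatorname{Re}\tau(x_1)<-L$ for $x_1<-L$, and $\widetilde\varphi(x_1,x_2)=\varphi(\tau(x_1),x_2)$ satisfies: for every $\delta>0$ there is $K$ with $$|\widetilde\varphi(x_1,x_2)|\le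 K\left(e^{-k|\operatorname{Im}\tau(x_1)|}+e^{-\gamma_1|\operatorname{Re}\tau(x_1)|}\right),\qquad |x_1|\ge L+\delta,\ x_2\in[-1,0].$$ If moreover $|\operatorname{Im}\tau(x_1)|\ge\beta|x_1|-b$ for $|x_1|>L$, with some $\beta>0$ and $b\in\mathbb R$, then $\widetilde\varphi$ decays exponentially: for every $\delta>0$ there is $K$ with $|\widetilde\varphi(x_1,x_2)|\le Ke^{-\min(\beta k,\,c\gamma_1)|x_1|}$ for $|x_1|\ge L+\delta$, $x_2\in[-1,0]$. 4. For the linear PML with $a>0$, $c>0$, that is $\tau(x_1)=x_1$ for $|x_1|<a$, $\tau(x_1)=x_1+ic(x_1-a)$ for $x_1\ge a$ and $\tau(x_1)=x_1+ic(x_1+a)$ for $x_1\le-a$: for every $\delta>0$ there is $K$ with $$|\widetilde\varphi(x_1,x_2)|\le Ke^{-\min(ck,\gamma_1)|x_1|},\qquad |x_1|\ge L+\delta,\ x_2\in[-1,0].$$ -/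

import Mathlib

open Filter Topology Set

noncomputable section

namespace WaterWaves

/-- The plane, with Euclidean structure; `x 0` and `x 1` are the coordinates `x₁` and `x₂`. -/
abbrev Plane : Type := EuclideanSpace ℝ (Fin 2)

/-- The geometry in dimensionless form: an open fluid region `Ωf` below the unperturbed free surface
`ℝ × {0}`, of constant depth `1` where `|x₁| > L₀`, and a bounded open region `Ωo` occupied by the
obstacles (possibly empty, possibly piercing the free surface). -/
structure Geometry where
  Ωf : Set Plane
  Ωo : Set Plane
  L₀ : ℝ
  L₀_pos : 0 < L₀
  isOpen_fluid : IsOpen Ωf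
  isOpen_obstacle : IsOpen Ωo
  isBounded_obstacle : Bornology.IsBounded Ωo
  below_surface : ∀ x ∈ Ωf, x 1 < 0
  surface_subset : ∀ x : Plane, x 1 = 0 → x ∈ frontier Ωf
  flat : ∀ x : Plane, L₀ < |x 0| → (x ∈ Ωf ↔ -1 < x 1 ∧ x 1 < 0)

namespace Geometry

variable (G : Geometry)

/-- The domain `Ω = Ωf \ closure Ωo` of the boundary value problem. -/
def Ω : Set Plane := G.Ωf \ closure G.Ωo

/-- The free surface `(ℝ × {0}) \ closure Ωo`. -/
def Γf : Set Plane := {x | x 1 = 0} \ closure G.Ωo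

/-- The bottom: the boundary of the fluid region apart from the line `ℝ × {0}`. -/
def Γb : Set Plane := frontier G.Ωf \ {x | x 1 = 0}

/-- The immersed part of the boundary of the obstacles. -/
def Γo : Set Plane := frontier G.Ωo ∩ closure G.Ωf

end Geometry

/-- `n` is the unit normal at the boundary point `x` of `Ω`, pointing into `Ω`: near `x` the set `Ω`
is `{ρ > 0}` with `ρ` of class `C¹`, `ρ x = 0`, and `∇ρ x` a positive multiple of `n`.
There is no such `n` at a corner. -/
def IsInwardUnitNormal (Ω : Set Plane) (x n : Plane) : Prop :=
  ‖n‖ = 1 ∧ ∃ ρ : Plane → ℝ, ContDiffAt ℝ 1 ρ x ∧ ρ x = 0 ∧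
    (∃ t : ℝ, 0 < t ∧ gradient ρ x = t • n) ∧ ∀ᶠ y in 𝓝 x, (y ∈ Ω ↔ 0 < ρ y)

/-- `φ` is a (classical) outgoing solution of the time-harmonic water-wave problem with Robin
parameter `ν`, wavenumber `k` and boundary data `f₁` (free surface), `f₂` (bottom and obstacles).
It is harmonic in `Ω`, continuous up to the boundary, its normal derivative has the prescribed
limits at the boundary points that have a normal, and `∂φ/∂x₁ ∓ i k φ → 0` as `x₁ → ±∞` in `Ω`
(uniformly in `x₂`). Corner points carry no boundary condition. -/
structure IsSolution (G : Geometry) (ν k : ℝ) (f₁ f₂ φ : Plane → ℂ) : Prop where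
  harmonic : InnerProductSpace.HarmonicOnNhd φ G.Ω
  continuousOn : ContinuousOn φ (closure G.Ω)
  free_surface : ∀ x ∈ G.Γf, ∀ n, IsInwardUnitNormal G.Ω x n →
    Tendsto (fun y => fderiv ℝ φ y n) (𝓝[G.Ω] x) (𝓝 (f₁ x - ν * φ x))
  solid : ∀ x ∈ G.Γb ∪ G.Γo, ∀ n, IsInwardUnitNormal G.Ω x n →
    Tendsto (fun y => fderiv ℝ φ y n) (𝓝[G.Ω] x) (𝓝 (f₂ x))
  radiation_right :
    Tendsto (fun x : Plane => fderiv ℝ φ x !₂[(1 : ℝ), 0] - Complex.I * k * φ x)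
      (comap (fun x : Plane => x 0) atTop ⊓ 𝓟 G.Ω) (𝓝 0)
  radiation_left :
    Tendsto (fun x : Plane => fderiv ℝ φ x !₂[(1 : ℝ), 0] + Complex.I * k * φ x)
      (comap (fun x : Plane => x 0) atBot ⊓ 𝓟 G.Ω) (𝓝 0)

/-- The unnormalized transverse modes: `cosh (k (x₂ + 1))` and `cos (γₙ (x₂ + 1))` for `n ≥ 1`. -/
def rawMode (k : ℝ) (γ : ℕ → ℝ) : ℕ → ℝ → ℝ
  | 0, s => Real.cosh (k * (s + 1))
  | n + 1, s => Real.cos (γ (n + 1) * (s + 1))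

/-- The transverse modes `uₙ`, normalized in `L²(-1, 0)`. -/
def mode (k : ℝ) (γ : ℕ → ℝ) (n : ℕ) (s : ℝ) : ℝ :=
  rawMode k γ n s / Real.sqrt (∫ t in (-1 : ℝ)..0, rawMode k γ n t ^ 2)

/-- The longitudinal factors: `exp (i k w)` and `exp (-γₙ w)` for `n ≥ 1`, where `w` is the (complex)
distance travelled away from the perturbed region. -/
def longitudinal (k : ℝ) (γ : ℕ → ℝ) : ℕ → ℂ → ℂ
  | 0, w => Complex.exp (Complex.I * k * w)
  | n + 1, w => Complex.exp (-(γ (n + 1) : ℂ) * w)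

/-- The modal coefficient of `φ` on the line `{x₁ = ℓ}` (the modes are real valued). -/
def coeff (k : ℝ) (γ : ℕ → ℝ) (φ : Plane → ℂ) (ℓ : ℝ) (n : ℕ) : ℂ :=
  ∫ s in (-1 : ℝ)..0, φ !₂[ℓ, s] * (mode k γ n s : ℂ)

/-- Partial sum, up to the mode of index `N`, of the modal expansion on the right,
evaluated at `(z, x₂)`. -/
def rightPartialSum (k : ℝ) (γ : ℕ → ℝ) (φ : Plane → ℂ) (L : ℝ) (N : ℕ) (z : ℂ) (s : ℝ) : ℂ :=
  ∑ n ∈ Finset.range (N + 1), coeff k γ φ L n * mode k γ n s * longitudinal k γ n (z - L)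

/-- Partial sum, up to the mode of index `N`, of the modal expansion on the left,
evaluated at `(z, x₂)`. -/
def leftPartialSum (k : ℝ) (γ : ℕ → ℝ) (φ : Plane → ℂ) (L : ℝ) (N : ℕ) (z : ℂ) (s : ℝ) : ℂ :=
  ∑ n ∈ Finset.range (N + 1), coeff k γ φ (-L) n * mode k γ n s * longitudinal k γ n (-(z + L))

/-- `Φ` extends `φ` from real `|x₁| > L` to complex `z₁` with `|Re z₁| > L`, holomorphically in `z₁`
for every `x₂ ∈ [-1, 0]`. -/
def IsHolomorphicExtension (L : ℝ) (φ : Plane → ℂ) (Φ : ℂ → ℝ → ℂ) : Prop :=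
  ∀ s ∈ Icc (-1 : ℝ) 0, DifferentiableOn ℂ (fun z => Φ z s) {z : ℂ | L < |z.re|} ∧
    ∀ x₁ : ℝ, L < |x₁| → Φ x₁ s = φ !₂[x₁, s]

/-- Stretching paths: continuous, differentiable off a locally finite set with
`c < Re τ' < C` there, equal to the identity on `(-L, L)`, in the upper half plane for `x₁ > L` and
in the lower half plane for `x₁ < -L`. -/
structure IsStretchingPath (L c C : ℝ) (τ : ℝ → ℂ) : Prop where
  c_pos : 0 < c
  continuous : Continuous τ
  im_pos : ∀ x, L < x → 0 < (τ x).im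
  im_neg : ∀ x, x < -L → (τ x).im < 0
  eq_self : ∀ x, |x| < L → τ x = x
  piecewise : ∃ S : Set ℝ, (∀ R : ℝ, (S ∩ Icc (-R) R).Finite) ∧
    ∀ x ∉ S, DifferentiableAt ℝ τ x ∧ c < (deriv τ x).re ∧ (deriv τ x).re < C

/-- The linear PML stretching with start `a` and slope `c`. -/
def linearPML (a c : ℝ) (x : ℝ) : ℂ :=
  x + Complex.I * ((if x ≤ -a then c * (x + a) else if x < a then 0 else c * (x - a) : ℝ) : ℂ)

end WaterWaves

end

noncomputable section

namespace WaterWaves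

/-! Beyond `L` the domain is a pair of half-strips with homogeneous boundary conditions, and the
reflection `pt (-1)` turns the left one into a right one. Projecting the solution on the transverse
modes should give coefficients solving `A'' = p² A` with `p = rate k γ n`, of which the radiation
condition keeps only the outgoing branch. Three points need work.

Regularity: the solution is only continuous up to the boundary, with limits of its normal
derivative, so the ODE is not directly available. On a depth interval `[-1+ε, -ε]` it holds up to a
boundary flux that tends to zero. The ODE is replaced by d'Alembert's equation `A(x+h) + A(x-h) = 2
cosh(ph) A(x)`, which contains no derivatives and survives `ε → 0` (`OutgoingWave.dAlembert`). Along
`x + jh` it is a linear recurrence, and the integrated radiation condition excludes its non-outgoing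
solution (`eq_of_dAlembert_recurrence`, `OutgoingWave.modal_shift`).

Completeness of the modes (`Dispersion.eq_zero_of_orthogonal`): if `h` is orthogonal to every mode,
its cosine transform vanishes at all zeros of `z sin z + ν cos z`. These are simple and are exactly
the numbers `± wavenumber k γ n`. The quotient is therefore entire, and it is `O(1/R)` on squares
avoiding the zeros, hence zero. The cosine coefficients of `h` then vanish, and so does `h`.

Holomorphy: `cos(p(s+1)) exp(-pw)` is the mean of `exp(-p(w ± i(s+1)))`. The modal series is thus
the mean of two values of one Dirichlet-type series `E`, holomorphic for `Re w > 0`. The extension,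
the Laplace equation up to the boundary and the convergence all follow from `E`; uniqueness is the
identity theorem. The decay comes from `|exp(ikw)| = exp(-k Im w)` and from comparing the other
terms with a geometric series times `exp(-γ₁ Re w)`. -/

/-! ### Entire quotients -/

/-- If the zeros of the entire function `D` are simple and are zeros of the entire function `F`,
then `D` divides `F`. -/
theorem exists_entire_quotient {F D : ℂ → ℂ} (hF : Differentiable ℂ F) (hD : Differentiable ℂ D)
    (h0 : ∀ z, D z = 0 → F z = 0 ∧ deriv D z ≠ 0) :
    ∃ G : ℂ → ℂ, Differentiable ℂ G ∧ ∀ z, F z = G z * D z := by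
  classical
  refine ⟨fun z => if D z = 0 then deriv F z / deriv D z else F z / D z, fun z₀ => ?_, fun z => ?_⟩
  · by_cases hz : D z₀ = 0
    · obtain ⟨hFz, hDz⟩ := h0 z₀ hz
      -- Near a zero of `D` the quotient equals that of the two entire difference quotients, the
      -- common factor `z - z₀` cancelling. Its value at `z₀` is `F'/D'`.
      have dF : Differentiable ℂ (dslope F z₀) := by
        rw [← differentiableOn_univ, Complex.differentiableOn_dslope univ_mem]
        exact hF.differentiableOn
      have dD : Differentiable ℂ (dslope D z₀) := by
        rw [← differentiableOn_univ, Complex.differentiableOn_dslope univ_mem]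
        exact hD.differentiableOn
      have hne : dslope D z₀ z₀ ≠ 0 := by rwa [dslope_same]
      have hev : ∀ᶠ z in 𝓝 z₀, dslope D z₀ z ≠ 0 :=
        (dD z₀).continuousAt.eventually_ne hne
      refine ((dF z₀).div (dD z₀) hne).congr_of_eventuallyEq ?_
      filter_upwards [hev] with z hzne
      rcases eq_or_ne z z₀ with rfl | hzz
      · simp [hz, dslope_same]
      · rw [dslope_of_ne _ hzz, slope_def_field, hz, sub_zero] at hzne
        have hDz' : D z ≠ 0 := fun h => hzne (by simp [h])
        have hs : z - z₀ ≠ 0 := sub_ne_zero.2 hzz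
        simp only [hDz', if_false, Pi.div_apply]
        rw [dslope_of_ne _ hzz, dslope_of_ne _ hzz, slope_def_field, slope_def_field, hz, hFz]
        field_simp
        ring
    · refine ((hF z₀).div (hD z₀) hz).congr_of_eventuallyEq ?_
      filter_upwards [(hD z₀).continuousAt.eventually_ne hz] with z hz'
      simp [hz']
  · by_cases hz : D z = 0
    · simp [hz, (h0 z hz).1]
    · simp [hz]

/-- An entire function that is small on arbitrarily large squares vanishes. -/
theorem eq_zero_of_small_on_squares {G : ℂ → ℂ} (hG : Differentiable ℂ G)
    (R ε : ℕ → ℝ) (hR : Tendsto R atTop atTop) (hε : Tendsto ε atTop (𝓝 0))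
    (h : ∀ᶠ N in atTop, ∀ z : ℂ, |z.re| ≤ R N → |z.im| ≤ R N → (|z.re| = R N ∨ |z.im| = R N) →
      ‖G z‖ ≤ ε N) (z : ℂ) : G z = 0 := by
  have key : ∀ᶠ N in atTop, ‖G z‖ ≤ ε N := by
    filter_upwards [h, hR.eventually_gt_atTop (max |z.re| |z.im|)] with N hN hRN
    have hpos : 0 < R N := lt_of_le_of_lt (le_max_of_le_left (abs_nonneg _)) hRN
    have hne : -R N < R N := by linarith
    have hb : Bornology.IsBounded (Ioo (-R N) (R N) ×ℂ Ioo (-R N) (R N)) :=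
      (Metric.isBounded_Ioo _ _).reProdIm (Metric.isBounded_Ioo _ _)
    -- Maximum modulus principle on the square once it contains `z`.
    refine Complex.norm_le_of_forall_mem_frontier_norm_le hb (hG.diffContOnCl) (fun w hw => ?_)
      (subset_closure ?_)
    · rw [Complex.frontier_reProdIm, closure_Ioo hne.ne, frontier_Ioo hne] at hw
      rcases hw with hw | hw
      · obtain ⟨h1, h2⟩ := Complex.mem_reProdIm.1 hw
        simp only [mem_insert_iff, mem_singleton_iff] at h1 h2
        refine hN w (abs_le.2 h1) ?_ (Or.inr ?_)
        · rcases h2 with h2 | h2 <;> simp [h2, abs_of_pos hpos]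
        · rcases h2 with h2 | h2 <;> simp [h2, abs_of_pos hpos]
      · obtain ⟨h1, h2⟩ := Complex.mem_reProdIm.1 hw
        simp only [mem_insert_iff, mem_singleton_iff] at h1 h2
        refine hN w ?_ (abs_le.2 h2) (Or.inl ?_)
        · rcases h1 with h1 | h1 <;> simp [h1, abs_of_pos hpos]
        · rcases h1 with h1 | h1 <;> simp [h1, abs_of_pos hpos]
    · rw [Complex.mem_reProdIm]
      exact ⟨abs_lt.1 (lt_of_le_of_lt (le_max_left _ _) hRN),
        abs_lt.1 (lt_of_le_of_lt (le_max_right _ _) hRN)⟩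
  have := ge_of_tendsto hε key
  exact norm_le_zero_iff.1 this

/-! ### The characteristic function of the transverse problem -/

/-- The entire function `z sin z + ν cos z`, whose zeros are the transverse wavenumbers. -/
def charFn (ν : ℝ) (z : ℂ) : ℂ := z * Complex.sin z + ν * Complex.cos z

theorem hasDerivAt_charFn (ν : ℝ) (z : ℂ) :
    HasDerivAt (charFn ν) (Complex.sin z + z * Complex.cos z - ν * Complex.sin z) z := by
  have h := ((hasDerivAt_id z).mul (Complex.hasDerivAt_sin z)).add
    ((Complex.hasDerivAt_cos z).const_mul (ν : ℂ))
  convert! h using 1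
  simp; ring

theorem differentiable_charFn (ν : ℝ) : Differentiable ℂ (charFn ν) :=
  fun z => (hasDerivAt_charFn ν z).differentiableAt

theorem norm_cos_le_cosh (z : ℂ) : ‖Complex.cos z‖ ≤ Real.cosh z.im := by
  rw [Complex.cos, Real.cosh_eq, norm_div]
  refine (div_le_div_of_nonneg_right (norm_add_le _ _) (norm_nonneg _)).trans (le_of_eq ?_)
  rw [Complex.norm_exp, Complex.norm_exp]
  simp
  ring

theorem normSq_sin (z : ℂ) : ‖Complex.sin z‖ ^ 2 = Real.sin z.re ^ 2 + Real.sinh z.im ^ 2 := by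
  conv_lhs => rw [← Complex.re_add_im z]
  rw [Complex.sin_add_mul_I, ← Complex.ofReal_sin, ← Complex.ofReal_cos, ← Complex.ofReal_cosh,
    ← Complex.ofReal_sinh, Complex.sq_norm, Complex.normSq_apply]
  simp [-Complex.ofReal_sin, -Complex.ofReal_cos, -Complex.ofReal_sinh, -Complex.ofReal_cosh]
  nlinarith [Real.sin_sq_add_cos_sq z.re, Real.cosh_sq z.im]

theorem abs_lt_abs_sinh {y : ℝ} (hy : y ≠ 0) : |y| < |Real.sinh y| := by
  rw [Real.abs_sinh]
  exact Real.self_lt_sinh_iff.2 (abs_pos.2 hy)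

/-- The zeros of the characteristic function are real or purely imaginary. -/
theorem charFn_zero_re_or_im {ν : ℝ} {z : ℂ} (hz : charFn ν z = 0) : z.re = 0 ∨ z.im = 0 := by
  by_contra! hne
  obtain ⟨hx, hy⟩ := hne
  set x := z.re
  set y := z.im
  have hzxy : z = x + y * Complex.I := (Complex.re_add_im z).symm
  have h1 := hz
  rw [charFn, hzxy, Complex.sin_add_mul_I, Complex.cos_add_mul_I, ← Complex.ofReal_sin,
    ← Complex.ofReal_cos, ← Complex.ofReal_cosh, ← Complex.ofReal_sinh] at h1
  have hre := congrArg Complex.re h1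
  have him := congrArg Complex.im h1
  simp [-Complex.ofReal_sin, -Complex.ofReal_cos, -Complex.ofReal_sinh, -Complex.ofReal_cosh]
    at hre him
  -- Eliminating `ν` between the real and imaginary parts. For `x, y ≠ 0` this is impossible,
  -- because `|sinh 2y| > |2y|` while `|sin 2x| < |2x|`.
  have key : x * Real.sinh (2 * y) + y * Real.sin (2 * x) = 0 := by
    rw [Real.sinh_two_mul, Real.sin_two_mul]
    have c1 := Real.sin_sq_add_cos_sq x
    have c2 := Real.cosh_sq y
    have e : 2 * (Real.cos x * Real.cosh y *
        (x * (Real.cos x * Real.sinh y) + y * (Real.sin x * Real.cosh y)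
          - ν * (Real.sin x * Real.sinh y))
        + Real.sin x * Real.sinh y * (x * (Real.sin x * Real.cosh y) - y * (Real.cos x * Real.sinh y)
          + ν * (Real.cos x * Real.cosh y))) = 0 := by
      have a1 : x * (Real.cos x * Real.sinh y) + y * (Real.sin x * Real.cosh y)
          - ν * (Real.sin x * Real.sinh y) = 0 := by linarith
      have a2 : x * (Real.sin x * Real.cosh y) - y * (Real.cos x * Real.sinh y)
          + ν * (Real.cos x * Real.cosh y) = 0 := by linarith
      rw [a1, a2]; ring
    have e2 : x * (2 * Real.sinh y * Real.cosh y) * (Real.sin x ^ 2 + Real.cos x ^ 2) +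
        y * (2 * Real.sin x * Real.cos x) * (Real.cosh y ^ 2 - Real.sinh y ^ 2) = 0 := by
      linarith
    rw [c1, c2] at e2
    linarith
  have h2 : |x * Real.sinh (2 * y)| = |y * Real.sin (2 * x)| := by
    rw [eq_neg_of_add_eq_zero_left key, abs_neg]
  rw [abs_mul, abs_mul] at h2
  have h3 := abs_lt_abs_sinh (mul_ne_zero two_ne_zero hy)
  have h4 := Real.abs_sin_lt_abs (mul_ne_zero two_ne_zero hx)
  rw [abs_mul, abs_two] at h3 h4
  have hx' := abs_pos.2 hx
  have hy' := abs_pos.2 hy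
  nlinarith

/-- At a double zero, eliminating `ν` leaves `sin 2z = -2z`. On the real and imaginary axes the
strict inequalities for `sin` and `sinh` then force `z = 0`, where `charFn` equals `ν ≠ 0`. -/
theorem deriv_charFn_ne_zero {ν : ℝ} (hν : ν ≠ 0) {z : ℂ} (hz : charFn ν z = 0) :
    deriv (charFn ν) z ≠ 0 := by
  rw [(hasDerivAt_charFn ν z).deriv]
  intro hd
  have hz0 : z ≠ 0 := by
    rintro rfl
    simp [charFn, hν] at hz
  have h1 : z + Complex.sin z * Complex.cos z = 0 := by
    have := Complex.sin_sq_add_cos_sq z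
    unfold charFn at hz
    linear_combination hd * Complex.cos z + hz * Complex.sin z - z * this
  have h2 : 2 * z + Complex.sin (2 * z) = 0 := by
    rw [Complex.sin_two_mul]; linear_combination 2 * h1
  rcases charFn_zero_re_or_im hz with h | h
  · have hzy : z = z.im * Complex.I := by
      apply Complex.ext <;> simp [h]
    have hy : z.im ≠ 0 := fun h' => hz0 (by rw [hzy, h']; simp)
    rw [hzy, ← mul_assoc, Complex.sin_mul_I] at h2
    have h3 := congrArg Complex.im h2
    have e : Complex.sinh (2 * (z.im : ℂ)) = ((Real.sinh (2 * z.im) : ℝ) : ℂ) := by push_cast; rfl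
    rw [e] at h3
    simp [-Complex.ofReal_sinh] at h3
    have h4 := abs_lt_abs_sinh (mul_ne_zero two_ne_zero hy)
    rw [eq_neg_of_add_eq_zero_right h3, abs_neg] at h4
    exact lt_irrefl _ h4
  · have hzx : z = (z.re : ℂ) := by
      apply Complex.ext <;> simp [h]
    have hx : z.re ≠ 0 := fun h' => hz0 (by rw [hzx, h']; simp)
    rw [hzx] at h2
    have h3 : 2 * z.re + Real.sin (2 * z.re) = 0 := by exact_mod_cast h2
    have h4 := Real.abs_sin_lt_abs (mul_ne_zero two_ne_zero hx)
    rw [eq_neg_of_add_eq_zero_right h3, abs_neg] at h4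
    exact lt_irrefl _ h4

/-- The equation reads `|y| tanh |y| = k tanh k`, and `t tanh t` is injective for `t ≥ 0`. The sign
of `sinh (k - |y|)`, expanded, stands in for the monotonicity of `tanh`. -/
theorem charFn_zero_imag {ν k : ℝ} (hk : 0 < k) (hkν : k * Real.tanh k = ν) {y : ℝ}
    (hz : charFn ν (y * Complex.I) = 0) : |y| = k := by
  have h1 : y * Real.sinh y = ν * Real.cosh y := by
    rw [charFn, Complex.sin_mul_I, Complex.cos_mul_I, ← Complex.ofReal_sinh,
      ← Complex.ofReal_cosh] at hz
    have := congrArg Complex.re hz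
    simp [-Complex.ofReal_sinh, -Complex.ofReal_cosh] at this
    linarith
  have habs : |y| * Real.sinh |y| = ν * Real.cosh |y| := by
    rcases abs_cases y with ⟨h, _⟩ | ⟨h, _⟩ <;> rw [h] <;> simp [h1]
  have hk1 : k * Real.sinh k = ν * Real.cosh k := by
    rw [← hkν, Real.tanh_eq_sinh_div_cosh]
    field_simp [(Real.cosh_pos k).ne']
  have hs : Real.sinh k * Real.cosh |y| * k = Real.sinh |y| * Real.cosh k * |y| := by
    linear_combination Real.cosh |y| * hk1 - Real.cosh k * habs
  have hy0 : 0 ≤ |y| := abs_nonneg y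
  rcases lt_trichotomy |y| k with h | h | h
  · exfalso
    have hp : 0 < Real.sinh (k - |y|) := Real.sinh_pos_iff.2 (by linarith)
    rw [Real.sinh_sub] at hp
    have h5 : 0 < Real.sinh k * Real.cosh |y| := mul_pos (Real.sinh_pos_iff.2 hk) (Real.cosh_pos _)
    have h6 : 0 ≤ Real.sinh |y| * Real.cosh k :=
      mul_nonneg (Real.sinh_nonneg_iff.2 hy0) (Real.cosh_pos _).le
    nlinarith
  · exact h
  · exfalso
    have hp : 0 < Real.sinh (|y| - k) := Real.sinh_pos_iff.2 (by linarith)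
    rw [Real.sinh_sub] at hp
    have h5 : 0 < Real.sinh k * Real.cosh |y| := mul_pos (Real.sinh_pos_iff.2 hk) (Real.cosh_pos _)
    have h6 : 0 ≤ Real.sinh |y| * Real.cosh k :=
      mul_nonneg (Real.sinh_nonneg_iff.2 hy0) (Real.cosh_pos _).le
    nlinarith

/-! ### Completeness of the transverse modes -/

/-- Joint continuity bounds `f'` on a compact neighbourhood, which supplies the dominating constant.
The scalar field is left general: the cosine transform needs `ℂ`, the truncated modal coefficients
need `ℝ`. -/
theorem hasDerivAt_integral_of_continuousOn {𝕜 E : Type*} [RCLike 𝕜] [NormedAddCommGroup E]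
    [NormedSpace ℝ E] [NormedSpace 𝕜 E] {f f' : 𝕜 → ℝ → E} {U : Set 𝕜} (hU : IsOpen U) {a b : ℝ}
    (hab : a ≤ b) (hf : ∀ x ∈ U, ContinuousOn (f x) (Icc a b))
    (hd : ∀ x ∈ U, ∀ s ∈ Icc a b, HasDerivAt (fun x => f x s) (f' x s) x)
    (hc : ContinuousOn (fun p : 𝕜 × ℝ => f' p.1 p.2) (U ×ˢ Icc a b)) {x₀ : 𝕜} (hx₀ : x₀ ∈ U) :
    HasDerivAt (fun x => ∫ s in a..b, f x s) (∫ s in a..b, f' x₀ s) x₀ := by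
  obtain ⟨r, hr, hrU⟩ := Metric.nhds_basis_closedBall.mem_iff.1 (hU.mem_nhds hx₀)
  have hK : IsCompact (Metric.closedBall x₀ r ×ˢ Icc a b) :=
    (isCompact_closedBall x₀ r).prod isCompact_Icc
  obtain ⟨M, hM⟩ := hK.exists_bound_of_continuousOn
    (hc.mono (prod_mono hrU subset_rfl))
  have hsub : uIoc a b ⊆ Icc a b := by rw [uIoc_of_le hab]; exact Ioc_subset_Icc_self
  have hf'x : ContinuousOn (f' x₀) (Icc a b) :=
    hc.comp (f := fun s => (x₀, s)) (by fun_prop) fun s hs => ⟨hx₀, hs⟩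
  refine (intervalIntegral.hasDerivAt_integral_of_dominated_loc_of_deriv_le
    (s := Metric.closedBall x₀ r) (bound := fun _ => M)
    (Metric.closedBall_mem_nhds x₀ hr) ?_ ?_ ?_ ?_ ?_ ?_).2
  · filter_upwards [hU.mem_nhds hx₀] with x hx
    exact ((hf x hx).mono hsub).aestronglyMeasurable measurableSet_uIoc
  · exact ((hf x₀ hx₀).mono (by rw [uIcc_of_le hab])).intervalIntegrable
  · exact (hf'x.mono hsub).aestronglyMeasurable measurableSet_uIoc
  · exact Eventually.of_forall fun s hs x hx => hM (x, s) ⟨hx, hsub hs⟩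
  · exact intervalIntegrable_const
  · exact Eventually.of_forall fun s hs x hx => hd x (hrU hx) s (hsub hs)

/-- A continuous function on `[0, 1]` all of whose cosine coefficients vanish is zero. -/
theorem eq_zero_of_cosine_coeffs {g : ℝ → ℂ} (hg : ContinuousOn g (Icc 0 1))
    (h : ∀ n : ℤ, ∫ t in (0 : ℝ)..1, g t * Complex.cos (n * Real.pi * t) = 0) {t : ℝ}
    (ht : t ∈ Icc (0 : ℝ) 1) : g t = 0 := by
  have : Fact ((0 : ℝ) < 2) := ⟨two_pos⟩
  -- The Fourier coefficients of the even 2-periodic extension are the cosine coefficients of `g`.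
  -- All vanish, so the Fourier series is trivially summable and represents the function.
  set H : ℝ → ℂ := fun t => g |t| with hH
  have hHc : ContinuousOn H (Icc (-1) (-1 + 2)) := by
    refine hg.comp (continuous_abs.continuousOn) fun x hx => ⟨abs_nonneg _, abs_le.2 ⟨hx.1, ?_⟩⟩
    linarith [hx.2]
  have hHe : H (-1) = H (-1 + 2) := by norm_num [hH]
  let f : C(AddCircle (2 : ℝ), ℂ) := ⟨AddCircle.liftIco 2 (-1) H, AddCircle.liftIco_continuous hHe hHc⟩
  have hcoef : ∀ n, fourierCoeff f n = 0 := by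
    intro n
    change fourierCoeff (AddCircle.liftIco 2 (-1) H) n = 0
    rw [fourierCoeff_liftIco_eq, fourierCoeffOn_eq_integral]
    have hi : ∀ a b : ℝ, -1 ≤ a → a ≤ b → b ≤ 1 → ∀ m : ℤ, IntervalIntegrable
        (fun x : ℝ => Complex.exp (m * Real.pi * x * Complex.I) * H x) MeasureTheory.volume a b := by
      intro a b ha hab hb m
      refine ContinuousOn.intervalIntegrable ?_
      rw [uIcc_of_le hab]
      refine ContinuousOn.mul (by fun_prop) (hHc.mono (Icc_subset_Icc ha (by linarith)))
    have e1 : ∀ x : ℝ, (fourier (-n) (x : AddCircle ((-1 : ℝ) + 2 - -1))) • H x =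
        Complex.exp ((-n : ℤ) * Real.pi * x * Complex.I) * H x := by
      intro x
      rw [fourier_coe_apply, smul_eq_mul]
      congr 2
      push_cast
      ring
    simp_rw [e1]
    have e2 : (-1 : ℝ) + 2 = 1 := by norm_num
    rw [e2, ← intervalIntegral.integral_add_adjacent_intervals
      (hi (-1) 0 le_rfl (by norm_num) (by norm_num) (-n))
      (hi 0 1 (by norm_num) (by norm_num) le_rfl (-n))]
    have e3 : ∫ x in (-1 : ℝ)..0, Complex.exp ((-n : ℤ) * Real.pi * x * Complex.I) * H x =
        ∫ x in (0 : ℝ)..1, Complex.exp ((n : ℤ) * Real.pi * x * Complex.I) * H x := by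
      have := intervalIntegral.integral_comp_neg (a := 0) (b := 1)
        (fun x : ℝ => Complex.exp ((-n : ℤ) * Real.pi * x * Complex.I) * H x)
      rw [neg_zero] at this
      rw [← this]
      refine intervalIntegral.integral_congr fun x _ => ?_
      simp [hH]
    rw [e3, ← intervalIntegral.integral_add (hi 0 1 (by norm_num) (by norm_num) le_rfl n)
      (hi 0 1 (by norm_num) (by norm_num) le_rfl (-n))]
    have e4 : ∫ x in (0 : ℝ)..1, (Complex.exp ((n : ℤ) * Real.pi * x * Complex.I) * H x +
        Complex.exp ((-n : ℤ) * Real.pi * x * Complex.I) * H x) =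
        ∫ x in (0 : ℝ)..1, 2 * (g x * Complex.cos (n * Real.pi * x)) := by
      refine intervalIntegral.integral_congr fun x hx => ?_
      rw [uIcc_of_le zero_le_one] at hx
      simp only [hH, abs_of_nonneg hx.1, Complex.cos]
      push_cast
      ring_nf
    rw [e4, intervalIntegral.integral_const_mul, h n]
    simp
  have hs : Summable (fourierCoeff f) := by
    rw [show (fourierCoeff f) = fun _ => 0 from funext hcoef]; exact summable_zero
  have hz : ∀ x, f x = 0 := fun x => by
    have := has_pointwise_sum_fourier_series_of_summable hs x
    simp only [hcoef, zero_smul] at this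
    exact this.unique hasSum_zero
  have hlt : ∀ t ∈ Ico (0 : ℝ) 1, g t = 0 := fun t ht => by
    have h1 : AddCircle.liftIco 2 (-1) H (t : AddCircle (2 : ℝ)) = H t :=
      AddCircle.liftIco_coe_apply ⟨by linarith [ht.1], by linarith [ht.2]⟩
    have h2 : AddCircle.liftIco 2 (-1) H (t : AddCircle (2 : ℝ)) = 0 := hz t
    rw [← abs_of_nonneg ht.1]
    exact h1.symm.trans h2
  -- The fundamental domain `[-1, 1)` omits `t = 1`, which is recovered by continuity.
  have hcl : closure (Ico (0 : ℝ) 1) = Icc 0 1 := closure_Ico (by norm_num)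
  have : EqOn g (fun _ => 0) (Icc 0 1) :=
    EqOn.of_subset_closure (s := Ico (0 : ℝ) 1) hlt hg continuousOn_const Ico_subset_Icc_self hcl.ge
  exact this ht

/-- The wavenumbers `i k`, `γ₁`, `γ₂`, ... as complex numbers: the `n`-th raw mode is
`cos (wavenumber n * (x₂ + 1))`. -/
def wavenumber (k : ℝ) (γ : ℕ → ℝ) : ℕ → ℂ
  | 0 => k * Complex.I
  | n + 1 => γ (n + 1)

theorem rawMode_eq_cos (k : ℝ) (γ : ℕ → ℝ) (n : ℕ) (s : ℝ) :
    (rawMode k γ n s : ℂ) = Complex.cos (wavenumber k γ n * (s + 1)) := by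
  cases n with
  | zero =>
    simp only [rawMode, wavenumber]
    rw [mul_right_comm, Complex.cos_mul_I]
    push_cast; rfl
  | succ n => simp only [rawMode, wavenumber]; push_cast; rfl

/-- The dispersion relations satisfied by the wavenumbers. -/
structure Dispersion (ν k : ℝ) (γ : ℕ → ℝ) : Prop where
  ν_pos : 0 < ν
  k_pos : 0 < k
  k_eq : k * Real.tanh k = ν
  γ_eq : ∀ n : ℕ, 1 ≤ n → γ n * Real.tan (γ n) = -ν ∧
      n * Real.pi - Real.pi / 2 < γ n ∧ γ n < n * Real.pi

/-! ### Location of the zeros of the characteristic function -/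

namespace Dispersion

variable {ν k : ℝ} {γ : ℕ → ℝ}

theorem cos_γ_ne_zero (hd : Dispersion ν k γ) {n : ℕ} (hn : 1 ≤ n) : Real.cos (γ n) ≠ 0 := by
  intro h
  have := (hd.γ_eq n hn).1
  -- Where the cosine vanishes, `Real.tan` takes the value `0`, which would give `ν = 0`.
  rw [Real.tan_eq_sin_div_cos, h, div_zero, mul_zero] at this
  linarith [hd.ν_pos]

theorem γ_pos (hd : Dispersion ν k γ) {n : ℕ} (hn : 1 ≤ n) : 0 < γ n := by
  have h1 := (hd.γ_eq n hn).2.1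
  have : (1 : ℝ) ≤ n := by exact_mod_cast hn
  nlinarith [Real.pi_pos]

theorem γ_mul_sin (hd : Dispersion ν k γ) {n : ℕ} (hn : 1 ≤ n) :
    γ n * Real.sin (γ n) + ν * Real.cos (γ n) = 0 := by
  have h := (hd.γ_eq n hn).1
  have hc := hd.cos_γ_ne_zero hn
  rw [Real.tan_eq_sin_div_cos] at h
  field_simp at h
  linarith

/-- The wavenumbers are, up to sign, all the zeros of the characteristic function. -/
theorem exists_wavenumber (hd : Dispersion ν k γ) {z : ℂ} (hz : charFn ν z = 0) :
    ∃ n, z = wavenumber k γ n ∨ z = -wavenumber k γ n := by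
  rcases charFn_zero_re_or_im hz with h | h
  · have hzy : z = z.im * Complex.I := by
      apply Complex.ext <;> simp [h]
    rw [hzy] at hz
    have := charFn_zero_imag hd.k_pos hd.k_eq hz
    refine ⟨0, ?_⟩
    simp only [wavenumber]
    rcases (abs_eq hd.k_pos.le).1 this with h' | h'
    · left; rw [hzy, h']
    · right; rw [hzy, h']; push_cast; ring
  · have hzx : z = (z.re : ℂ) := by
      apply Complex.ext <;> simp [h]
    have h1 : z.re * Real.sin z.re + ν * Real.cos z.re = 0 := by
      rw [hzx, charFn] at hz
      exact_mod_cast hz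
    -- The characteristic function is even, so only `x > 0` matters.
    set x := |z.re| with hx
    have h2 : x * Real.sin x + ν * Real.cos x = 0 := by
      rcases abs_cases z.re with ⟨h', _⟩ | ⟨h', _⟩ <;> rw [hx, h'] <;> simp [h1]
    have hcos : Real.cos x ≠ 0 := by
      intro hc
      rw [hc, mul_zero, add_zero] at h2
      rcases mul_eq_zero.1 h2 with h3 | h3
      · rw [h3, Real.cos_zero] at hc; exact one_ne_zero hc
      · have := Real.sin_sq_add_cos_sq x
        rw [h3, hc] at this; norm_num at this
    have hx0 : 0 < x := by
      refine lt_of_le_of_ne (abs_nonneg _) fun h0 => ?_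
      rw [← h0] at h2
      simp at h2
      exact hd.ν_pos.ne' h2
    -- the integer `m` nearest to `x / π`
    obtain ⟨m, hm1, hm2⟩ : ∃ m : ℕ, m * Real.pi - Real.pi / 2 ≤ x ∧ x < m * Real.pi + Real.pi / 2 := by
      refine ⟨⌊x / Real.pi + 1 / 2⌋₊, ?_, ?_⟩
      · have := Nat.floor_le (a := x / Real.pi + 1 / 2) (by positivity)
        have h3 : x = (x / Real.pi) * Real.pi := by field_simp
        nlinarith [Real.pi_pos]
      · have := Nat.lt_floor_add_one (x / Real.pi + 1 / 2)
        have h3 : x = (x / Real.pi) * Real.pi := by field_simp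
        nlinarith [Real.pi_pos]
    have hlt : x < m * Real.pi := by
      -- On `[mπ, mπ + π/2)` the tangent is nonnegative, whereas the equation makes it `-ν/x < 0`.
      by_contra! hge
      have htan : Real.tan x = -ν / x := by
        rw [Real.tan_eq_sin_div_cos]; field_simp; linarith
      have hneg : -ν / x < 0 := div_neg_of_neg_of_pos (by linarith [hd.ν_pos]) hx0
      have := Real.tan_nonneg_of_nonneg_of_le_pi_div_two (x := x - m * Real.pi) (by linarith)
        (by linarith)
      rw [Real.tan_sub_nat_mul_pi, htan] at this
      linarith
    have hm : 1 ≤ m := by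
      by_contra! hm0
      have : m = 0 := by omega
      subst this
      simp at hlt
      linarith
    have hmne : m * Real.pi - Real.pi / 2 < x := by
      refine lt_of_le_of_ne hm1 fun he => hcos ?_
      rw [← he, Real.cos_sub_pi_div_two, Real.sin_nat_mul_pi]
    obtain ⟨-, hg2, hg3⟩ := hd.γ_eq m hm
    have hγ : γ m * Real.sin (γ m) + ν * Real.cos (γ m) = 0 := hd.γ_mul_sin hm
    have hmr : (1 : ℝ) ≤ m := by exact_mod_cast hm
    have hsum : Real.pi < x + γ m := by nlinarith [Real.pi_pos]
    -- Two roots in the same window: `ν` is eliminated between their equations. With `d` their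
    -- distance and `S > π` their sum, Jordan's inequality gives `S sin d > 2d`, too large to be
    -- cancelled by `d sin S`.
    have hcross : (x - γ m) * Real.sin (x + γ m) + (x + γ m) * Real.sin (x - γ m) = 0 := by
      rw [Real.sin_add, Real.sin_sub]
      linear_combination 2 * Real.cos (γ m) * h2 - 2 * Real.cos x * hγ
    have key : ∀ d S : ℝ, 0 < d → d ≤ Real.pi / 2 → Real.pi < S →
        d * Real.sin S + S * Real.sin d ≠ 0 := by
      intro d S hd0 hd1 hS h0
      have e1 := Real.mul_le_sin hd0.le hd1
      have e2 := Real.neg_one_le_sin S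
      have e3 : Real.pi * (2 / Real.pi * d) = 2 * d := by field_simp
      have e4 : 0 < 2 / Real.pi * d := by positivity
      nlinarith
    have heq : x = γ m := by
      rcases lt_trichotomy x (γ m) with hl | he | hl
      · refine absurd ?_ (key (γ m - x) (x + γ m) (by linarith) (by linarith) hsum)
        have : γ m - x = -(x - γ m) := by ring
        rw [this, Real.sin_neg]
        linarith
      · exact he
      · exact absurd hcross (key (x - γ m) (x + γ m) (by linarith) (by linarith) hsum)
    obtain ⟨n, rfl⟩ : ∃ n, m = n + 1 := ⟨m - 1, by omega⟩
    refine ⟨n + 1, ?_⟩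
    simp only [wavenumber]
    rcases (abs_eq (hd.γ_pos hm).le).1 heq with h' | h'
    · left; rw [hzx, h']
    · right; rw [hzx, h']; push_cast; rfl

end Dispersion

/-! ### Growth of the characteristic function and of cosine transforms -/

/-- From `|sin z|² = sin² x + sinh² y`: on the vertical sides `sin² x = 1`, so `|sin z| = cosh y`;
on the horizontal sides `sinh² y ≥ 1`, so `cosh² y ≤ 2 sinh² y`. -/
theorem half_cosh_le_norm_sin {R : ℝ} (hR : 1 ≤ R) (hs : Real.sin R ^ 2 = 1) {z : ℂ}
    (hz : |z.re| = R ∨ |z.im| = R) : Real.cosh z.im / 2 ≤ ‖Complex.sin z‖ := by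
  have hsq := normSq_sin z
  have hc := Real.cosh_sq z.im
  have hcp := Real.cosh_pos z.im
  refine abs_le_of_sq_le_sq' ?_ (norm_nonneg _) |>.2
  rw [hsq]
  rcases hz with h | h
  · have : Real.sin z.re ^ 2 = 1 := by
      rw [← hs, ← h, ← sq_abs (Real.sin |z.re|)]
      rcases abs_cases z.re with ⟨h', _⟩ | ⟨h', _⟩ <;> rw [h'] <;> simp
    nlinarith [sq_nonneg (Real.sinh z.im)]
  · have h1 : R ≤ |Real.sinh z.im| := by
      rw [Real.abs_sinh, h]
      exact Real.self_le_sinh_iff.2 (by linarith)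
    have h2 : 1 ≤ Real.sinh z.im ^ 2 := by
      rw [← sq_abs]; nlinarith
    nlinarith [sq_nonneg (Real.sin z.re)]

/-- On the square `z sin z` dominates `ν cos z`, with a factor `R` to spare over the `cosh (Im z)`
growth of a cosine transform. -/
theorem le_norm_charFn {ν R : ℝ} (hν : 0 < ν) (hR : 1 ≤ R) (hs : Real.sin R ^ 2 = 1) {z : ℂ}
    (hz : |z.re| = R ∨ |z.im| = R) : (R / 2 - ν) * Real.cosh z.im ≤ ‖charFn ν z‖ := by
  have h1 := half_cosh_le_norm_sin hR hs hz
  have h2 := norm_cos_le_cosh z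
  have h3 : R ≤ ‖z‖ := by
    rcases hz with h | h
    · rw [← h]; exact Complex.abs_re_le_norm z
    · rw [← h]; exact Complex.abs_im_le_norm z
  have hcp := Real.cosh_pos z.im
  have h4 : ‖z * Complex.sin z‖ - ‖(ν : ℂ) * Complex.cos z‖ ≤ ‖charFn ν z‖ := by
    have := norm_sub_norm_le (z * Complex.sin z) (-((ν : ℂ) * Complex.cos z))
    rwa [norm_neg, sub_neg_eq_add] at this
  rw [norm_mul, norm_mul, Complex.norm_real, Real.norm_of_nonneg hν.le] at h4
  have h5 : R * (Real.cosh z.im / 2) ≤ ‖z‖ * ‖Complex.sin z‖ :=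
    mul_le_mul h3 h1 (by positivity) (by positivity)
  nlinarith

/-- The cosine transform of a function on `[-1, 0]`. -/
def cosTransform (h : ℝ → ℂ) (z : ℂ) : ℂ := ∫ s in (-1 : ℝ)..0, h s * Complex.cos (z * (s + 1))

theorem differentiable_cosTransform {h : ℝ → ℂ} (hh : ContinuousOn h (Icc (-1) 0)) :
    Differentiable ℂ (cosTransform h) := by
  intro z
  refine (hasDerivAt_integral_of_continuousOn (f := fun z s => h s * Complex.cos (z * (s + 1)))
    (f' := fun (z : ℂ) (s : ℝ) => h s * (-Complex.sin (z * (s + 1)) * (s + 1)))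
    (U := univ) isOpen_univ (by norm_num)
    (fun x _ => hh.mul (by fun_prop)) (fun x _ s _ => ?_) ?_ (mem_univ z)).differentiableAt
  · refine HasDerivAt.const_mul _ ?_
    have := ((hasDerivAt_id x).mul_const ((s : ℂ) + 1)).ccos
    simpa using this
  · refine ContinuousOn.mul ?_ (by fun_prop)
    exact hh.comp continuousOn_snd fun p hp => hp.2

theorem norm_cosTransform_le {h : ℝ → ℂ} {M : ℝ} (hM : ∀ s ∈ Icc (-1 : ℝ) 0, ‖h s‖ ≤ M) (z : ℂ) :
    ‖cosTransform h z‖ ≤ M * Real.cosh z.im := by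
  have := intervalIntegral.norm_integral_le_of_norm_le_const (a := (-1 : ℝ)) (b := 0)
    (f := fun s => h s * Complex.cos (z * (s + 1))) (C := M * Real.cosh z.im) ?_
  · simpa [cosTransform] using this
  · intro s hs
    rw [uIoc_of_le (by norm_num)] at hs
    rw [norm_mul]
    refine mul_le_mul (hM s (Ioc_subset_Icc_self hs)) ((norm_cos_le_cosh _).trans ?_)
      (norm_nonneg _) ((norm_nonneg _).trans (hM s (Ioc_subset_Icc_self hs)))
    rw [Real.cosh_le_cosh]
    have : (z * ((s : ℂ) + 1)).im = z.im * (s + 1) := by simp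
    rw [this, abs_mul]
    have : |s + 1| ≤ 1 := abs_le.2 ⟨by linarith [hs.1], by linarith [hs.2]⟩
    exact mul_le_of_le_one_right (abs_nonneg _) this

/-- Completeness of the transverse modes. -/
theorem Dispersion.eq_zero_of_orthogonal {ν k : ℝ} {γ : ℕ → ℝ} (hd : Dispersion ν k γ)
    {h : ℝ → ℂ} (hh : ContinuousOn h (Icc (-1) 0))
    (ho : ∀ n, ∫ s in (-1 : ℝ)..0, h s * (rawMode k γ n s : ℂ) = 0) {s : ℝ}
    (hs : s ∈ Icc (-1 : ℝ) 0) : h s = 0 := by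
  obtain ⟨M, hM⟩ := isCompact_Icc.exists_bound_of_continuousOn hh
  have hM0 : 0 ≤ M := (norm_nonneg _).trans (hM s hs)
  have hzero : ∀ n, cosTransform h (wavenumber k γ n) = 0 := fun n => by
    rw [← ho n]
    simp only [cosTransform, rawMode_eq_cos]
  obtain ⟨G, hG, hFG⟩ := exists_entire_quotient (differentiable_cosTransform hh)
    (differentiable_charFn ν) fun z hz => by
      refine ⟨?_, deriv_charFn_ne_zero hd.ν_pos.ne' hz⟩
      obtain ⟨n, rfl | rfl⟩ := hd.exists_wavenumber hz
      · exact hzero n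
      · rw [← hzero n]
        simp only [cosTransform, neg_mul, Complex.cos_neg]
  -- Half-widths at which `sin² R = 1`, so that the squares avoid the zeros for large `N`.
  set R : ℕ → ℝ := fun N => N * Real.pi + Real.pi / 2 with hRdef
  have hRs : ∀ N, Real.sin (R N) ^ 2 = 1 := fun N => by
    rw [hRdef]
    simp only [Real.sin_add_pi_div_two]
    have := Real.sin_sq_add_cos_sq (N * Real.pi)
    rw [Real.sin_nat_mul_pi] at this
    linarith
  have hR1 : ∀ N, 1 ≤ R N := fun N => by
    have : 0 ≤ N * Real.pi := by positivity
    have := Real.pi_gt_three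
    simp only [hRdef]
    linarith
  have hRt : Tendsto R atTop atTop :=
    tendsto_atTop_add_const_right _ _ (tendsto_natCast_atTop_atTop.atTop_mul_const Real.pi_pos)
  have hden : Tendsto (fun N => R N / 2 - ν) atTop atTop :=
    tendsto_atTop_add_const_right _ (-ν) (hRt.atTop_div_const two_pos)
  have hGz : ∀ z, G z = 0 := by
    refine eq_zero_of_small_on_squares hG R (fun N => M / (R N / 2 - ν)) hRt
      (hden.const_div_atTop M) ?_
    filter_upwards [hden.eventually_gt_atTop 0] with N hN z _ _ hz
    rw [le_div_iff₀ hN]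
    have h1 := le_norm_charFn hd.ν_pos (hR1 N) (hRs N) hz
    have h2 := norm_cosTransform_le hM z
    rw [hFG z, norm_mul] at h2
    have hcp := Real.cosh_pos z.im
    have h3 := mul_le_mul_of_nonneg_left h1 (norm_nonneg (G z))
    refine le_of_mul_le_mul_right ?_ hcp
    linarith
  have hF : ∀ z, cosTransform h z = 0 := fun z => by rw [hFG z, hGz z, zero_mul]
  -- After the shift `t = s + 1`, the values of the transform at `nπ` are the cosine coefficients.
  have hg : ContinuousOn (fun t : ℝ => h (t - 1)) (Icc 0 1) :=
    hh.comp (by fun_prop) fun t ht => ⟨by linarith [ht.1], by linarith [ht.2]⟩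
  have := eq_zero_of_cosine_coeffs hg (fun n => ?_) (t := s + 1)
    ⟨by linarith [hs.1], by linarith [hs.2]⟩
  · simpa using this
  · rw [← hF (n * Real.pi), cosTransform]
    have := intervalIntegral.integral_comp_sub_right (a := 0) (b := 1)
      (fun s : ℝ => h s * Complex.cos (n * Real.pi * (s + 1))) 1
    norm_num at this
    exact this

/-! ### Orthogonality of the transverse modes -/

/-- The derivatives of the raw modes. -/
def rawModeDeriv (k : ℝ) (γ : ℕ → ℝ) : ℕ → ℝ → ℝ
  | 0, s => k * Real.sinh (k * (s + 1))
  | n + 1, s => -(γ (n + 1) * Real.sin (γ (n + 1) * (s + 1)))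

/-- The eigenvalues `-k²`, `γ₁²`, `γ₂²`, ... of `-∂²` on the transverse modes. -/
def eigenvalue (k : ℝ) (γ : ℕ → ℝ) : ℕ → ℝ
  | 0 => -k ^ 2
  | n + 1 => γ (n + 1) ^ 2

/-- The decay rates of the longitudinal factors, `-i k` and `γₙ`. -/
def rate (k : ℝ) (γ : ℕ → ℝ) : ℕ → ℂ
  | 0 => -(Complex.I * k)
  | n + 1 => γ (n + 1)

theorem longitudinal_eq (k : ℝ) (γ : ℕ → ℝ) (n : ℕ) (w : ℂ) :
    longitudinal k γ n w = Complex.exp (-rate k γ n * w) := by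
  cases n <;> simp [longitudinal, rate]

theorem rate_sq (k : ℝ) (γ : ℕ → ℝ) (n : ℕ) : rate k γ n ^ 2 = eigenvalue k γ n := by
  cases n with
  | zero => simp [rate, eigenvalue, mul_pow]
  | succ n => simp [rate, eigenvalue]

theorem hasDerivAt_rawMode (k : ℝ) (γ : ℕ → ℝ) (n : ℕ) (s : ℝ) :
    HasDerivAt (rawMode k γ n) (rawModeDeriv k γ n s) s := by
  cases n with
  | zero =>
    have := (((hasDerivAt_id s).add_const (1 : ℝ)).const_mul k).cosh
    simpa [rawMode, rawModeDeriv, mul_comm, Function.comp_def] using! this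
  | succ n =>
    have := (((hasDerivAt_id s).add_const (1 : ℝ)).const_mul (γ (n + 1))).cos
    simpa [rawMode, rawModeDeriv, mul_comm, Function.comp_def] using! this

theorem hasDerivAt_rawModeDeriv (k : ℝ) (γ : ℕ → ℝ) (n : ℕ) (s : ℝ) :
    HasDerivAt (rawModeDeriv k γ n) (-eigenvalue k γ n * rawMode k γ n s) s := by
  cases n with
  | zero =>
    have := ((((hasDerivAt_id s).add_const (1 : ℝ)).const_mul k).sinh).const_mul k
    convert! this using 1
    simp [rawMode, eigenvalue]; ring
  | succ n =>
    have := (((((hasDerivAt_id s).add_const (1 : ℝ)).const_mul (γ (n + 1))).sin).const_mul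
      (γ (n + 1))).neg
    convert! this using 1
    simp [rawMode, eigenvalue]; ring

theorem continuous_rawMode (k : ℝ) (γ : ℕ → ℝ) (n : ℕ) : Continuous (rawMode k γ n) :=
  continuous_iff_continuousAt.2 fun s => (hasDerivAt_rawMode k γ n s).continuousAt

theorem continuous_rawModeDeriv (k : ℝ) (γ : ℕ → ℝ) (n : ℕ) : Continuous (rawModeDeriv k γ n) :=
  continuous_iff_continuousAt.2 fun s => (hasDerivAt_rawModeDeriv k γ n s).continuousAt

theorem rawModeDeriv_neg_one (k : ℝ) (γ : ℕ → ℝ) (n : ℕ) : rawModeDeriv k γ n (-1) = 0 := by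
  cases n <;> simp [rawModeDeriv]

theorem abs_rawMode_le (k : ℝ) (γ : ℕ → ℝ) (n : ℕ) {s : ℝ} (hs : s ∈ Icc (-1 : ℝ) 0) :
    |rawMode k γ n s| ≤ Real.cosh k := by
  cases n with
  | zero =>
    simp only [rawMode]
    rw [abs_of_pos (Real.cosh_pos _), Real.cosh_le_cosh, abs_mul]
    exact mul_le_of_le_one_right (abs_nonneg _)
      (abs_le.2 ⟨by linarith [hs.1], by linarith [hs.2]⟩)
  | succ n => exact (Real.abs_cos_le_one _).trans (Real.one_le_cosh _)

namespace Dispersion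

variable {ν k : ℝ} {γ : ℕ → ℝ}

/-- The dispersion relations are exactly the Robin condition at the surface. With
`rawModeDeriv_neg_one` at the bottom, it makes the boundary terms in Green's formula cancel. -/
theorem rawModeDeriv_zero (hd : Dispersion ν k γ) (n : ℕ) :
    rawModeDeriv k γ n 0 = ν * rawMode k γ n 0 := by
  cases n with
  | zero =>
    have h := hd.k_eq
    rw [Real.tanh_eq_sinh_div_cosh] at h
    have hc := (Real.cosh_pos k).ne'
    field_simp at h
    simp [rawMode, rawModeDeriv]
    linarith
  | succ n =>
    have := hd.γ_mul_sin (n := n + 1) (by omega)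
    simp [rawMode, rawModeDeriv]
    linarith

theorem γ_lt_γ_succ (hd : Dispersion ν k γ) {n : ℕ} (hn : 1 ≤ n) : γ n < γ (n + 1) := by
  have h1 := (hd.γ_eq n hn).2.2
  have h2 := (hd.γ_eq (n + 1) (by omega)).2.1
  push_cast at h2
  linarith [Real.pi_pos]

theorem natCast_le_γ (hd : Dispersion ν k γ) {n : ℕ} (hn : 1 ≤ n) : (n : ℝ) ≤ γ n := by
  have h1 := (hd.γ_eq n hn).2.1
  have : (1 : ℝ) ≤ n := by exact_mod_cast hn
  nlinarith [Real.pi_gt_three]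

theorem γ_mono (hd : Dispersion ν k γ) : StrictMono fun n => γ (n + 1) :=
  strictMono_nat_of_lt_succ fun _ => hd.γ_lt_γ_succ (by omega)

theorem eigenvalue_strictMono (hd : Dispersion ν k γ) : StrictMono (eigenvalue k γ) := by
  refine strictMono_nat_of_lt_succ fun n => ?_
  cases n with
  | zero =>
    have := hd.γ_pos (le_refl 1)
    have := hd.k_pos
    simp only [eigenvalue]
    have h1 : 0 < k ^ 2 := by positivity
    have h2 : 0 < γ (0 + 1) ^ 2 := by simp; positivity
    linarith
  | succ n =>
    simp only [eigenvalue]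
    have h1 := hd.γ_pos (n := n + 1) (by omega)
    have h2 := hd.γ_lt_γ_succ (n := n + 1) (by omega)
    nlinarith

/-- Sturm–Liouville argument: the Wronskian vanishes at both ends, its derivative is the eigenvalue
difference times the product of the modes, and the eigenvalues are distinct. -/
theorem integral_rawMode_mul (hd : Dispersion ν k γ) {m n : ℕ} (hmn : m ≠ n) :
    ∫ s in (-1 : ℝ)..0, rawMode k γ m s * rawMode k γ n s = 0 := by
  have hderiv : ∀ s ∈ uIcc (-1 : ℝ) 0, HasDerivAt
      (fun s => rawModeDeriv k γ m s * rawMode k γ n s - rawMode k γ m s * rawModeDeriv k γ n s)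
      ((eigenvalue k γ n - eigenvalue k γ m) * (rawMode k γ m s * rawMode k γ n s)) s := by
    intro s _
    have := ((hasDerivAt_rawModeDeriv k γ m s).mul (hasDerivAt_rawMode k γ n s)).sub
      ((hasDerivAt_rawMode k γ m s).mul (hasDerivAt_rawModeDeriv k γ n s))
    convert! this using 1
    ring
  have hint := intervalIntegral.integral_eq_sub_of_hasDerivAt hderiv
    ((continuous_const.mul ((continuous_rawMode k γ m).mul
      (continuous_rawMode k γ n))).intervalIntegrable _ _)
  rw [intervalIntegral.integral_const_mul, hd.rawModeDeriv_zero, hd.rawModeDeriv_zero,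
    rawModeDeriv_neg_one, rawModeDeriv_neg_one] at hint
  have h0 : (eigenvalue k γ n - eigenvalue k γ m) *
      ∫ s in (-1 : ℝ)..0, rawMode k γ m s * rawMode k γ n s = 0 := by
    rw [hint]; ring
  exact (mul_eq_zero.1 h0).resolve_left
    (sub_ne_zero.2 fun h => hmn (hd.eigenvalue_strictMono.injective h).symm)

/-- Only uniformity in `n` matters: it bounds the modal coefficients. The integral is at least `1`
for `n = 0`, and otherwise `1/2 + sin(2γ)/(4γ)` with `γ ≥ 1`. -/
theorem quarter_le_integral_rawMode_sq (hd : Dispersion ν k γ) (n : ℕ) :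
    1 / 4 ≤ ∫ s in (-1 : ℝ)..0, rawMode k γ n s ^ 2 := by
  cases n with
  | zero =>
    have : ∫ s in (-1 : ℝ)..0, (1 : ℝ) ≤ ∫ s in (-1 : ℝ)..0, rawMode k γ 0 s ^ 2 := by
      refine intervalIntegral.integral_mono_on (by norm_num) (by simp)
        (((continuous_rawMode k γ 0).pow 2).intervalIntegrable _ _) fun s _ => ?_
      exact one_le_pow₀ (Real.one_le_cosh _)
    simp at this
    linarith
  | succ n =>
    have h1 := hd.natCast_le_γ (n := n + 1) (by omega)
    have hγ : 1 ≤ γ (n + 1) := le_trans (by push_cast; linarith [Nat.cast_nonneg (α := ℝ) n]) h1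
    have h2 : ∫ s in (-1 : ℝ)..0, rawMode k γ (n + 1) s ^ 2 =
        1 / 2 + Real.sin (2 * γ (n + 1)) / (4 * γ (n + 1)) := by
      have hder : ∀ s ∈ uIcc (-1 : ℝ) 0, HasDerivAt
          (fun s => s / 2 + Real.sin (2 * γ (n + 1) * (s + 1)) / (4 * γ (n + 1)))
          (rawMode k γ (n + 1) s ^ 2) s := by
        intro s _
        have := ((hasDerivAt_id s).div_const 2).add
          (((((hasDerivAt_id s).add_const (1 : ℝ)).const_mul (2 * γ (n + 1))).sin).div_const
            (4 * γ (n + 1)))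
        convert! this using 1
        have e : 2 * γ (n + 1) * (s + 1) = 2 * (γ (n + 1) * (s + 1)) := by ring
        simp only [rawMode, id]
        rw [e, Real.cos_two_mul]
        field_simp
        ring
      rw [intervalIntegral.integral_eq_sub_of_hasDerivAt hder
        (((continuous_rawMode k γ (n + 1)).pow 2).intervalIntegrable _ _)]
      simp
      ring
    rw [h2]
    have h3 : -(1 / 4) ≤ Real.sin (2 * γ (n + 1)) / (4 * γ (n + 1)) := by
      rw [le_div_iff₀ (by positivity)]
      linarith [Real.neg_one_le_sin (2 * γ (n + 1))]
    linarith

theorem rate_ne_zero (hd : Dispersion ν k γ) (n : ℕ) : rate k γ n ≠ 0 := by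
  cases n with
  | zero => simp [rate, hd.k_pos.ne']
  | succ n => simpa [rate] using (hd.γ_pos (n := n + 1) (by omega)).ne'

end Dispersion

/-! ### A perturbed d'Alembert identity for `f'' = p² f` -/

/-- For `q = ±p`, the derivative of `(J' - qJ) exp(qt)` is `(J'' - p² J) exp(qt)`, so both
first-order combinations are small, and their difference is `2pJ`. One exponential factor bounds the
integrand, the other undoes the integrating factor. -/
theorem norm_le_of_second_order {p : ℂ} (hp : p ≠ 0) {J J' J'' : ℝ → ℂ} {h β : ℝ} (hh : 0 ≤ h)
    (hJ : ∀ t ∈ Icc 0 h, HasDerivAt J (J' t) t) (hJ' : ∀ t ∈ Icc 0 h, HasDerivAt J' (J'' t) t)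
    (hb : ∀ t ∈ Icc 0 h, ‖J'' t - p ^ 2 * J t‖ ≤ β) (h0 : J 0 = 0) (h0' : J' 0 = 0) :
    ‖J h‖ ≤ β * (Real.exp (‖p‖ * h) ^ 2 * h / ‖p‖) := by
  have hp' : 0 < ‖p‖ := norm_pos_iff.2 hp
  have hexp : ∀ q : ℂ, ‖q‖ = ‖p‖ → ∀ t ∈ Icc 0 h, ‖Complex.exp (q * t)‖ ≤ Real.exp (‖p‖ * h) := by
    intro q hq t ht
    rw [Complex.norm_exp]
    refine Real.exp_le_exp.2 ?_
    calc (q * t).re ≤ ‖q * t‖ := Complex.re_le_norm _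
      _ = ‖p‖ * t := by rw [norm_mul, hq, Complex.norm_real, Real.norm_of_nonneg ht.1]
      _ ≤ ‖p‖ * h := by gcongr; exact ht.2
  have hβ : 0 ≤ β := (norm_nonneg _).trans (hb 0 ⟨le_rfl, hh⟩)
  have main : ∀ q : ℂ, ‖q‖ = ‖p‖ → q ^ 2 = p ^ 2 →
      ‖(J' h - q * J h) * Complex.exp (q * h)‖ ≤ β * Real.exp (‖p‖ * h) * h := by
    intro q hq hq2
    have := norm_image_sub_le_of_norm_deriv_le_segment'
      (f := fun t : ℝ => (J' t - q * J t) * Complex.exp (q * t))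
      (f' := fun t : ℝ => (J'' t - p ^ 2 * J t) * Complex.exp (q * t)) (a := 0) (b := h)
      (C := β * Real.exp (‖p‖ * h)) (fun t ht => ?_) (fun t ht => ?_) h ⟨hh, le_rfl⟩
    · simpa [h0, h0'] using this
    · have he : HasDerivAt (fun t : ℝ => Complex.exp (q * t)) (Complex.exp (q * t) * q) t := by
        have := ((hasDerivAt_id t).ofReal_comp.const_mul q).cexp
        simpa using this
      have := (((hJ' t ht).sub ((hJ t ht).const_mul q)).mul he)
      refine HasDerivAt.hasDerivWithinAt ?_
      convert! this using 1
      rw [← hq2]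
      simp only [Pi.sub_apply]
      ring
    · rw [norm_mul]
      exact mul_le_mul (hb t (Ico_subset_Icc_self ht)) (hexp q hq t (Ico_subset_Icc_self ht))
        (norm_nonneg _) hβ
  have e1 := main p rfl rfl
  have e2 := main (-p) (norm_neg p) (by ring)
  have hmul : ∀ q : ℂ, ‖q‖ = ‖p‖ →
      ‖(J' h - q * J h) * Complex.exp (q * h)‖ ≤ β * Real.exp (‖p‖ * h) * h →
      ‖J' h - q * J h‖ ≤ β * Real.exp (‖p‖ * h) ^ 2 * h := by
    intro q hq hle
    have e : J' h - q * J h = (J' h - q * J h) * Complex.exp (q * h) * Complex.exp (-q * h) := by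
      rw [mul_assoc, ← Complex.exp_add]; simp
    rw [e, norm_mul]
    calc _ ≤ (β * Real.exp (‖p‖ * h) * h) * Real.exp (‖p‖ * h) :=
          mul_le_mul hle (hexp (-q) (by rw [norm_neg, hq]) h ⟨hh, le_rfl⟩) (norm_nonneg _)
            (by positivity)
      _ = _ := by ring
  have f1 := hmul p rfl e1
  have f2 := hmul (-p) (norm_neg p) e2
  have f3 : 2 * ‖p‖ * ‖J h‖ ≤ 2 * (β * Real.exp (‖p‖ * h) ^ 2 * h) := by
    calc 2 * ‖p‖ * ‖J h‖ = ‖(J' h - -p * J h) - (J' h - p * J h)‖ := by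
          rw [show (J' h - -p * J h) - (J' h - p * J h) = 2 * p * J h by ring, norm_mul, norm_mul]
          simp
      _ ≤ _ := by
          refine (norm_sub_le _ _).trans ?_
          linarith
  rw [← mul_div_assoc, le_div_iff₀ hp']
  linarith

/-- As a function of `h`, the defect has zero Cauchy data, and its residual is the sum of the
residuals of `f` at `x + t` and `x - t`, whence `2β`. No derivative of `f` appears in the
conclusion, so it passes to limits. -/
theorem norm_dAlembert_le {p : ℂ} (hp : p ≠ 0) {f f' f'' : ℝ → ℂ} {x h β : ℝ} (hh : 0 ≤ h)
    (hf : ∀ t ∈ Icc (x - h) (x + h), HasDerivAt f (f' t) t)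
    (hf' : ∀ t ∈ Icc (x - h) (x + h), HasDerivAt f' (f'' t) t)
    (hb : ∀ t ∈ Icc (x - h) (x + h), ‖f'' t - p ^ 2 * f t‖ ≤ β) :
    ‖f (x + h) + f (x - h) - 2 * Complex.cosh (p * h) * f x‖ ≤
      2 * β * (Real.exp (‖p‖ * h) ^ 2 * h / ‖p‖) := by
  have hp1 : ∀ t ∈ Icc 0 h, x + t ∈ Icc (x - h) (x + h) := fun t ht =>
    ⟨by linarith [ht.1], by linarith [ht.2]⟩
  have hm1 : ∀ t ∈ Icc 0 h, x - t ∈ Icc (x - h) (x + h) := fun t ht =>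
    ⟨by linarith [ht.2], by linarith [ht.1]⟩
  have hlin : ∀ t : ℝ, HasDerivAt (fun t : ℝ => p * (t : ℂ)) p t := fun t => by
    simpa using (hasDerivAt_id t).ofReal_comp.const_mul p
  have hch : ∀ t : ℝ, HasDerivAt (fun t : ℝ => Complex.cosh (p * t)) (Complex.sinh (p * t) * p) t :=
    fun t => (Complex.hasDerivAt_cosh _).comp t (hlin t)
  have hsh : ∀ t : ℝ, HasDerivAt (fun t : ℝ => Complex.sinh (p * t)) (Complex.cosh (p * t) * p) t :=
    fun t => (Complex.hasDerivAt_sinh _).comp t (hlin t)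
  refine norm_le_of_second_order hp
    (J := fun t => f (x + t) + f (x - t) - 2 * Complex.cosh (p * t) * f x)
    (J' := fun t => f' (x + t) - f' (x - t) - 2 * (Complex.sinh (p * t) * p) * f x)
    (J'' := fun t => f'' (x + t) + f'' (x - t) - 2 * (Complex.cosh (p * t) * p * p) * f x)
    hh (fun t ht => ?_) (fun t ht => ?_) (fun t ht => ?_) ?_ ?_
  · have a1 := (hf _ (hp1 t ht)).comp_const_add x t
    have a2 := (hf _ (hm1 t ht)).comp_const_sub x t
    convert! (a1.add a2).sub (((hch t).const_mul 2).mul_const (f x)) using 1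
  · have a1 := (hf' _ (hp1 t ht)).comp_const_add x t
    have a2 := (hf' _ (hm1 t ht)).comp_const_sub x t
    convert! (a1.sub a2).sub ((((hsh t).mul_const p).const_mul 2).mul_const (f x)) using 1
    ring
  · have e : f'' (x + t) + f'' (x - t) - 2 * (Complex.cosh (p * t) * p * p) * f x -
        p ^ 2 * (f (x + t) + f (x - t) - 2 * Complex.cosh (p * t) * f x) =
        (f'' (x + t) - p ^ 2 * f (x + t)) + (f'' (x - t) - p ^ 2 * f (x - t)) := by ring
    rw [e, two_mul]
    exact (norm_add_le _ _).trans (add_le_add (hb _ (hp1 t ht)) (hb _ (hm1 t ht)))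
  · simp; ring
  · simp

/-! ### Outgoing waves in a half-strip -/

/-- An outgoing wave in the half-strip `{x > L, -1 < s < 0}`, with its partial derivatives
(index `1` for `x`, index `2` for `s`) and homogeneous boundary conditions. -/
structure OutgoingWave (ν k L : ℝ) (g g₁ g₁₁ g₂ g₂₂ : ℝ → ℝ → ℂ) : Prop where
  cont : ContinuousOn (fun q : ℝ × ℝ => g q.1 q.2) (Ici L ×ˢ Icc (-1) 0)
  cont₁ : ContinuousOn (fun q : ℝ × ℝ => g₁ q.1 q.2) (Ioi L ×ˢ Ioo (-1) 0)
  cont₁₁ : ContinuousOn (fun q : ℝ × ℝ => g₁₁ q.1 q.2) (Ioi L ×ˢ Ioo (-1) 0)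
  deriv₁ : ∀ x > L, ∀ s ∈ Ioo (-1 : ℝ) 0, HasDerivAt (fun x => g x s) (g₁ x s) x
  deriv₁₁ : ∀ x > L, ∀ s ∈ Ioo (-1 : ℝ) 0, HasDerivAt (fun x => g₁ x s) (g₁₁ x s) x
  deriv₂ : ∀ x > L, ∀ s ∈ Ioo (-1 : ℝ) 0, HasDerivAt (g x) (g₂ x s) s
  deriv₂₂ : ∀ x > L, ∀ s ∈ Ioo (-1 : ℝ) 0, HasDerivAt (g₂ x) (g₂₂ x s) s
  laplace : ∀ x > L, ∀ s ∈ Ioo (-1 : ℝ) 0, g₁₁ x s + g₂₂ x s = 0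
  surface : ∀ x > L, Tendsto (fun q : ℝ × ℝ => g₂ q.1 q.2) (𝓝[Ioi L ×ˢ Ioo (-1) 0] (x, 0))
    (𝓝 (ν * g x 0))
  bottom : ∀ x > L, Tendsto (fun q : ℝ × ℝ => g₂ q.1 q.2) (𝓝[Ioi L ×ˢ Ioo (-1) 0] (x, -1)) (𝓝 0)
  radiation : ∀ η > 0, ∃ R, ∀ x > R, x > L → ∀ s ∈ Ioo (-1 : ℝ) 0,
    ‖g₁ x s - Complex.I * k * g x s‖ ≤ η

/-- The limits are joint in both variables, so compactness of `K` makes them uniform along the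
boundary. -/
theorem eventually_forall_norm_le_of_tendsto {T : ℝ × ℝ → ℂ} {U V K : Set ℝ} {s₀ : ℝ}
    (hK : IsCompact K) (hKU : K ⊆ U)
    (hT : ∀ y ∈ K, Tendsto T (𝓝[U ×ˢ V] (y, s₀)) (𝓝 0)) {β : ℝ} (hβ : 0 < β) :
    ∀ᶠ s in 𝓝[V] s₀, ∀ y ∈ K, ‖T (y, s)‖ ≤ β := by
  refine hK.induction_on (p := fun S => ∀ᶠ s in 𝓝[V] s₀, ∀ y ∈ S, ‖T (y, s)‖ ≤ β) (by simp)
    (fun S S' h hS' => hS'.mono fun s hs y hy => hs y (h hy))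
    (fun S S' hS hS' => ?_) (fun y hy => ?_)
  · filter_upwards [hS, hS'] with s h1 h2 y hy
    exact hy.elim (h1 y) (h2 y)
  · have h1 : ∀ᶠ q in 𝓝[U] y ×ˢ 𝓝[V] s₀, ‖T q‖ ≤ β := by
      rw [← nhdsWithin_prod_eq]
      filter_upwards [(hT y hy).norm.eventually_le_const (u := β) (by simpa using hβ)] with q hq
      exact hq
    obtain ⟨pa, ha, pb, hb, hab⟩ := eventually_prod_iff.1 h1
    exact ⟨{y | pa y}, nhdsWithin_mono y hKU ha, hb.mono fun s hs y hy => hab hy hs⟩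

/-- The defect `D j = a (j+1) - exp(-q) a j` is multiplied by `exp q` at each step, so its norm
cannot decrease, and `D → 0` forces `D = 0`. For the propagating mode `exp(-q) = ω` and the limit is
the hypothesis. Otherwise `(exp q - ω) D j` is a combination of two consecutive terms `a (j+1) - ω a
j`. -/
theorem eq_of_dAlembert_recurrence {a : ℕ → ℂ} {q ω : ℂ} (hq : 1 ≤ ‖Complex.exp q‖)
    (hrec : ∀ j, a (j + 2) + a j = 2 * Complex.cosh q * a (j + 1))
    (hω : Tendsto (fun j => a (j + 1) - ω * a j) atTop (𝓝 0))
    (hqω : Complex.exp (-q) = ω ∨ Complex.exp q ≠ ω) : a 1 = Complex.exp (-q) * a 0 := by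
  set D : ℕ → ℂ := fun j => a (j + 1) - Complex.exp (-q) * a j with hD
  have hee : Complex.exp q * Complex.exp (-q) = 1 := by rw [← Complex.exp_add]; simp
  have hstep : ∀ j, D (j + 1) = Complex.exp q * D j := fun j => by
    have h1 := hrec j
    rw [Complex.cosh] at h1
    simp only [hD]
    linear_combination h1 + a j * hee
  have hDlim : Tendsto D atTop (𝓝 0) := by
    rcases hqω with h | h
    · simpa only [hD, h] using hω
    · have h1 : Tendsto (fun j => (a (j + 1 + 1) - ω * a (j + 1)) -
          Complex.exp (-q) * (a (j + 1) - ω * a j)) atTop (𝓝 (0 - Complex.exp (-q) * 0)) :=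
        ((tendsto_add_atTop_iff_nat 1).2 hω).sub (hω.const_mul _)
      have h2 := h1.const_mul (Complex.exp q - ω)⁻¹
      simp only [mul_zero, sub_zero] at h2
      refine h2.congr fun j => ?_
      have h3 : Complex.exp q - ω ≠ 0 := sub_ne_zero.2 h
      rw [inv_mul_eq_iff_eq_mul₀ h3]
      have := hstep j
      simp only [hD] at this ⊢
      linear_combination this
  have hmono : Monotone fun j => ‖D j‖ := monotone_nat_of_le_succ fun j => by
    rw [hstep, norm_mul]
    exact le_mul_of_one_le_left (norm_nonneg _) hq
  have h0 : ‖D 0‖ ≤ 0 := by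
    have := hDlim.norm
    rw [norm_zero] at this
    exact ge_of_tendsto this (Eventually.of_forall fun j => hmono (Nat.zero_le j))
  have := norm_le_zero_iff.1 h0
  simp only [hD, zero_add] at this
  linear_combination this

namespace OutgoingWave

variable {ν k L : ℝ} {γ : ℕ → ℝ} {g g₁ g₁₁ g₂ g₂₂ : ℝ → ℝ → ℂ}

theorem continuousOn_section (hg : OutgoingWave ν k L g g₁ g₁₁ g₂ g₂₂) {x : ℝ} (hx : L ≤ x) :
    ContinuousOn (g x) (Icc (-1) 0) :=
  hg.cont.comp (f := fun s => (x, s)) (by fun_prop) fun _ hs => ⟨hx, hs⟩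

theorem continuousOn_section_mul (hg : OutgoingWave ν k L g g₁ g₁₁ g₂ g₂₂) (n : ℕ) {x : ℝ}
    (hx : L ≤ x) : ContinuousOn (fun s => g x s * (rawMode k γ n s : ℂ)) (Icc (-1) 0) :=
  (hg.continuousOn_section hx).mul
    (Complex.continuous_ofReal.comp (continuous_rawMode k γ n)).continuousOn

/-- The boundary flux of `g` against the `n`-th mode. -/
def flux (k : ℝ) (γ : ℕ → ℝ) (n : ℕ) (g g₂ : ℝ → ℝ → ℂ) (q : ℝ × ℝ) : ℂ :=
  g₂ q.1 q.2 * rawMode k γ n q.2 - g q.1 q.2 * rawModeDeriv k γ n q.2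

/-- The wave and the mode satisfy the same homogeneous condition at the end point, which is what
`h0` expresses. -/
theorem tendsto_flux (hg : OutgoingWave ν k L g g₁ g₁₁ g₂ g₂₂) (n : ℕ) {x s : ℝ} (hx : L < x)
    (hs : s ∈ Icc (-1 : ℝ) 0) {c : ℂ}
    (h : Tendsto (fun q : ℝ × ℝ => g₂ q.1 q.2) (𝓝[Ioi L ×ˢ Ioo (-1) 0] (x, s)) (𝓝 c))
    (h0 : c * rawMode k γ n s - g x s * rawModeDeriv k γ n s = 0) :
    Tendsto (flux k γ n g g₂) (𝓝[Ioi L ×ˢ Ioo (-1) 0] (x, s)) (𝓝 0) := by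
  rw [← h0]
  have hgc : Tendsto (fun q : ℝ × ℝ => g q.1 q.2) (𝓝[Ioi L ×ˢ Ioo (-1) 0] (x, s)) (𝓝 (g x s)) :=
    (hg.cont (x, s) ⟨hx.le, hs⟩).mono_left
      (nhdsWithin_mono _ (prod_mono Ioi_subset_Ici_self Ioo_subset_Icc_self))
  have hsnd : Tendsto (fun q : ℝ × ℝ => q.2) (𝓝[Ioi L ×ˢ Ioo (-1) 0] (x, s)) (𝓝 s) :=
    (continuous_snd.tendsto (x, s)).mono_left nhdsWithin_le_nhds
  exact (h.mul (((Complex.continuous_ofReal.comp (continuous_rawMode k γ n)).tendsto s).comp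
    hsnd)).sub (hgc.mul
      (((Complex.continuous_ofReal.comp (continuous_rawModeDeriv k γ n)).tendsto s).comp hsnd))

/-- Modal coefficients on an interior depth interval satisfy the modal equation up to fluxes. -/
theorem truncated_dAlembert (hg : OutgoingWave ν k L g g₁ g₁₁ g₂ g₂₂) (hd : Dispersion ν k γ)
    (n : ℕ) {a b x h β : ℝ} (ha : -1 < a) (hab : a ≤ b) (hb : b < 0) (hh : 0 ≤ h) (hx : L < x - h)
    (hβa : ∀ y ∈ Icc (x - h) (x + h), ‖flux k γ n g g₂ (y, a)‖ ≤ β)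
    (hβb : ∀ y ∈ Icc (x - h) (x + h), ‖flux k γ n g g₂ (y, b)‖ ≤ β) :
    ‖(∫ s in a..b, g (x + h) s * (rawMode k γ n s : ℂ)) +
        (∫ s in a..b, g (x - h) s * (rawMode k γ n s : ℂ)) -
        2 * Complex.cosh (rate k γ n * h) * ∫ s in a..b, g x s * (rawMode k γ n s : ℂ)‖ ≤
      2 * (2 * β) * (Real.exp (‖rate k γ n‖ * h) ^ 2 * h / ‖rate k γ n‖) := by
  have hsub : Icc a b ⊆ Ioo (-1) 0 := fun s hs => ⟨ha.trans_le hs.1, hs.2.trans_lt hb⟩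
  have hu : Continuous fun s => (rawMode k γ n s : ℂ) :=
    Complex.continuous_ofReal.comp (continuous_rawMode k γ n)
  have hsec : ∀ f : ℝ → ℝ → ℂ, ContinuousOn (fun q : ℝ × ℝ => f q.1 q.2) (Ioi L ×ˢ Ioo (-1) 0) →
      ∀ y ∈ Ioi L, ContinuousOn (fun s => f y s * (rawMode k γ n s : ℂ)) (Icc a b) :=
    fun f hf y hy => (hf.comp (f := fun s => (y, s)) (by fun_prop)
      fun s hs => ⟨hy, hsub hs⟩).mul hu.continuousOn
  have hjoint : ∀ f : ℝ → ℝ → ℂ, ContinuousOn (fun q : ℝ × ℝ => f q.1 q.2) (Ioi L ×ˢ Ioo (-1) 0) →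
      ContinuousOn (fun q : ℝ × ℝ => f q.1 q.2 * (rawMode k γ n q.2 : ℂ)) (Ioi L ×ˢ Icc a b) :=
    fun f hf => (hf.mono (prod_mono subset_rfl hsub)).mul (hu.comp continuous_snd).continuousOn
  have hg0 : ContinuousOn (fun q : ℝ × ℝ => g q.1 q.2) (Ioi L ×ˢ Ioo (-1) 0) :=
    hg.cont.mono (prod_mono Ioi_subset_Ici_self Ioo_subset_Icc_self)
  have hmem : ∀ y ∈ Icc (x - h) (x + h), y ∈ Ioi L := fun y hy => hx.trans_le hy.1
  refine norm_dAlembert_le (hd.rate_ne_zero n)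
    (f := fun x => ∫ s in a..b, g x s * (rawMode k γ n s : ℂ))
    (f' := fun x => ∫ s in a..b, g₁ x s * (rawMode k γ n s : ℂ))
    (f'' := fun x => ∫ s in a..b, g₁₁ x s * (rawMode k γ n s : ℂ)) hh
    (fun y hy => ?_) (fun y hy => ?_) (fun y hy => ?_)
  · exact hasDerivAt_integral_of_continuousOn isOpen_Ioi hab (hsec g hg0)
      (fun x hx s hs => (hg.deriv₁ x hx s (hsub hs)).mul_const _) (hjoint g₁ hg.cont₁) (hmem y hy)
  · exact hasDerivAt_integral_of_continuousOn isOpen_Ioi hab (hsec g₁ hg.cont₁)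
      (fun x hx s hs => (hg.deriv₁₁ x hx s (hsub hs)).mul_const _) (hjoint g₁₁ hg.cont₁₁)
      (hmem y hy)
  · have hy' := hmem y hy
    -- Green's formula in the depth: by Laplace's equation the residual of the modal ODE is, up to
    -- sign, the flux difference between the two ends, hence at most `2β`.
    have hder : ∀ s ∈ uIcc a b, HasDerivAt (fun s => flux k γ n g g₂ (y, s))
        (eigenvalue k γ n * (g y s * rawMode k γ n s) - g₁₁ y s * rawMode k γ n s) s := by
      intro s hs
      rw [uIcc_of_le hab] at hs
      have := ((hg.deriv₂₂ y hy' s (hsub hs)).mul (hasDerivAt_rawMode k γ n s).ofReal_comp).sub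
        ((hg.deriv₂ y hy' s (hsub hs)).mul (hasDerivAt_rawModeDeriv k γ n s).ofReal_comp)
      convert! this using 1
      have hl := hg.laplace y hy' s (hsub hs)
      push_cast
      linear_combination -(rawMode k γ n s : ℂ) * hl
    have i1 := (hsec g hg0 y hy').intervalIntegrable_of_Icc (μ := MeasureTheory.volume) hab
    have i2 := (hsec g₁₁ hg.cont₁₁ y hy').intervalIntegrable_of_Icc (μ := MeasureTheory.volume) hab
    have hint := intervalIntegral.integral_eq_sub_of_hasDerivAt hder ((i1.const_mul _).sub i2)
    rw [intervalIntegral.integral_sub (i1.const_mul _) i2,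
      intervalIntegral.integral_const_mul] at hint
    rw [rate_sq, norm_sub_rev, hint, two_mul]
    exact (norm_sub_le _ _).trans (add_le_add (hβb y hy) (hβa y hy))

theorem tendsto_truncated_integral {f : ℝ → ℂ} (hf : ContinuousOn f (Icc (-1) 0)) :
    Tendsto (fun ε : ℝ => ∫ s in (-1 + ε)..(-ε), f s) (𝓝[>] 0) (𝓝 (∫ s in (-1 : ℝ)..0, f s)) := by
  have hmem : ∀ᶠ ε : ℝ in 𝓝[>] 0, -1 + ε ∈ Icc (-1 : ℝ) 0 ∧ -ε ∈ Icc (-1 : ℝ) 0 := by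
    filter_upwards [Ioo_mem_nhdsGT (zero_lt_one' ℝ)] with ε hε
    exact ⟨⟨by linarith [hε.1], by linarith [hε.2]⟩, ⟨by linarith [hε.2], by linarith [hε.1]⟩⟩
  have hint : ∀ a ∈ Icc (-1 : ℝ) 0, IntervalIntegrable f MeasureTheory.volume (-1) a :=
    fun a ha => (hf.mono (Icc_subset_Icc_right ha.2)).intervalIntegrable_of_Icc ha.1
  have hprim : ContinuousOn (fun x => ∫ s in (-1 : ℝ)..x, f s) (Icc (-1) 0) := by
    have := intervalIntegral.continuousOn_primitive_interval (μ := MeasureTheory.volume)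
      (a := (-1 : ℝ)) (b := 0) (f := f) (by
        rw [uIcc_of_le (by norm_num)]; exact hf.integrableOn_Icc)
    rwa [uIcc_of_le (by norm_num)] at this
  have hlim : ∀ (a : ℝ) (φ : ℝ → ℝ), a ∈ Icc (-1 : ℝ) 0 → Continuous φ → φ 0 = a →
      (∀ᶠ ε in 𝓝[>] 0, φ ε ∈ Icc (-1 : ℝ) 0) →
      Tendsto (fun ε => ∫ s in (-1 : ℝ)..(φ ε), f s) (𝓝[>] 0) (𝓝 (∫ s in (-1 : ℝ)..a, f s)) := by
    intro a φ ha hφ h0 hev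
    refine (hprim a ha).tendsto.comp (tendsto_nhdsWithin_iff.2 ⟨?_, hev⟩)
    rw [← h0]
    exact (hφ.tendsto 0).mono_left nhdsWithin_le_nhds
  have h1 := hlim 0 (fun ε => -ε) (by norm_num) (by fun_prop) (by simp) (hmem.mono fun _ h => h.2)
  have h2 := hlim (-1) (fun ε => -1 + ε) (by norm_num) (by fun_prop) (by simp)
    (hmem.mono fun _ h => h.1)
  have h3 := h1.sub h2
  rw [intervalIntegral.integral_same, sub_zero] at h3
  refine h3.congr' ?_
  filter_upwards [hmem] with ε hε
  exact intervalIntegral.integral_interval_sub_left (hint _ hε.2) (hint _ hε.1)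

/-- The modal coefficients satisfy d'Alembert's functional equation. -/
theorem dAlembert (hg : OutgoingWave ν k L g g₁ g₁₁ g₂ g₂₂) (hd : Dispersion ν k γ)
    (n : ℕ) {x h : ℝ} (hh : 0 ≤ h) (hx : L < x - h) :
    (∫ s in (-1 : ℝ)..0, g (x + h) s * (rawMode k γ n s : ℂ)) +
        (∫ s in (-1 : ℝ)..0, g (x - h) s * (rawMode k γ n s : ℂ)) =
      2 * Complex.cosh (rate k γ n * h) * ∫ s in (-1 : ℝ)..0, g x s * (rawMode k γ n s : ℂ) := by
  have hlim : ∀ y, L ≤ y → Tendsto (fun ε : ℝ => ∫ s in (-1 + ε)..(-ε), g y s * (rawMode k γ n s : ℂ))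
      (𝓝[>] 0) (𝓝 (∫ s in (-1 : ℝ)..0, g y s * (rawMode k γ n s : ℂ))) := fun y hy =>
    tendsto_truncated_integral (hg.continuousOn_section_mul n hy)
  have hlimD := (((hlim (x + h) (by linarith)).add (hlim (x - h) (by linarith))).sub
    ((hlim x (by linarith)).const_mul (2 * Complex.cosh (rate k γ n * h)))).norm
  rw [← sub_eq_zero, ← norm_le_zero_iff]
  set C := Real.exp (‖rate k γ n‖ * h) ^ 2 * h / ‖rate k γ n‖
  have hC : 0 ≤ C := by positivity
  refine le_of_forall_pos_le_add fun η hη => ?_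
  rw [zero_add]
  -- The truncated estimate has total constant `4C`; the `+ 1` covers `C = 0`, which occurs for `h =
  -- 0`.
  have hβ : 0 < η / (4 * (C + 1)) := by positivity
  have hK : IsCompact (Icc (x - h) (x + h)) := isCompact_Icc
  have hKU : Icc (x - h) (x + h) ⊆ Ioi L := fun y hy => hx.trans_le hy.1
  have htop := eventually_forall_norm_le_of_tendsto hK hKU (fun y hy => hg.tendsto_flux (γ := γ) n
    (hKU hy) (right_mem_Icc.2 (by norm_num)) (hg.surface y (hKU hy))
      (by rw [hd.rawModeDeriv_zero]; push_cast; ring)) hβ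
  have hbot := eventually_forall_norm_le_of_tendsto hK hKU (fun y hy => hg.tendsto_flux (γ := γ) n
    (hKU hy) (left_mem_Icc.2 (by norm_num)) (hg.bottom y (hKU hy))
      (by rw [rawModeDeriv_neg_one]; simp)) hβ
  have hT : Tendsto (fun ε : ℝ => -ε) (𝓝[>] 0) (𝓝[Ioo (-1) 0] 0) := by
    refine tendsto_nhdsWithin_iff.2 ⟨?_, ?_⟩
    · have : Tendsto (fun ε : ℝ => -ε) (𝓝 0) (𝓝 (-0)) := continuous_neg.tendsto 0
      rw [neg_zero] at this
      exact this.mono_left nhdsWithin_le_nhds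
    · filter_upwards [Ioo_mem_nhdsGT (zero_lt_one' ℝ)] with ε hε
      exact ⟨by linarith [hε.2], by linarith [hε.1]⟩
  have hB : Tendsto (fun ε : ℝ => -1 + ε) (𝓝[>] 0) (𝓝[Ioo (-1) 0] (-1)) := by
    refine tendsto_nhdsWithin_iff.2 ⟨?_, ?_⟩
    · have : Tendsto (fun ε : ℝ => -1 + ε) (𝓝 0) (𝓝 (-1 + 0)) := (continuous_const_add _).tendsto 0
      rw [add_zero] at this
      exact this.mono_left nhdsWithin_le_nhds
    · filter_upwards [Ioo_mem_nhdsGT (zero_lt_one' ℝ)] with ε hε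
      exact ⟨by linarith [hε.1], by linarith [hε.2]⟩
  refine le_of_tendsto hlimD ?_
  filter_upwards [hT.eventually htop, hB.eventually hbot, Ioo_mem_nhdsGT (show (0 : ℝ) < 1 / 2 by norm_num)]
    with ε h1 h2 hε
  refine (hg.truncated_dAlembert hd n (by linarith [hε.1]) (by linarith [hε.2]) (by linarith [hε.1])
    hh hx h2 h1).trans ?_
  change 2 * (2 * (η / (4 * (C + 1)))) * C ≤ η
  have : 2 * (2 * (η / (4 * (C + 1)))) * C = η * (C / (C + 1)) := by field_simp; ring
  rw [this]
  exact mul_le_of_le_one_right hη.le ((div_le_one (by positivity)).2 (by linarith))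

/-- The radiation condition, integrated along the half-strip. -/
theorem tendsto_modal_shift (hg : OutgoingWave ν k L g g₁ g₁₁ g₂ g₂₂) (n : ℕ) {h : ℝ} (hh : 0 ≤ h) :
    Tendsto (fun x => (∫ s in (-1 : ℝ)..0, g (x + h) s * (rawMode k γ n s : ℂ)) -
      Complex.exp (Complex.I * k * h) * ∫ s in (-1 : ℝ)..0, g x s * (rawMode k γ n s : ℂ))
      atTop (𝓝 0) := by
  rw [NormedAddGroup.tendsto_nhds_zero]
  intro η hη
  set E := Real.cosh k with hE
  have hEpos : 0 < E := Real.cosh_pos k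
  set c := η / (2 * E * (h + 1)) with hc
  have hcpos : 0 < c := by positivity
  obtain ⟨R, hR⟩ := hg.radiation c hcpos
  filter_upwards [eventually_gt_atTop R, eventually_gt_atTop L] with x hxR hxL
  have hunit : ∀ t : ℝ, ‖Complex.exp (Complex.I * k * t)‖ = 1 := fun t => by
    rw [show Complex.I * k * t = ((k * t : ℝ) : ℂ) * Complex.I by push_cast; ring,
      Complex.norm_exp_ofReal_mul_I]
  -- The derivative of `exp(-ikt) g t s` is a unimodular factor times the radiation defect, at most
  -- `c` on an interval of length `h`.
  have hpt : ∀ s ∈ Ioo (-1 : ℝ) 0,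
      ‖g (x + h) s - Complex.exp (Complex.I * k * h) * g x s‖ ≤ c * h := by
    intro s hs
    have := norm_image_sub_le_of_norm_deriv_le_segment'
      (f := fun t : ℝ => Complex.exp (-(Complex.I * k) * t) * g t s)
      (f' := fun t : ℝ => Complex.exp (-(Complex.I * k) * t) * (g₁ t s - Complex.I * k * g t s))
      (a := x) (b := x + h) (C := c) (fun t ht => ?_) (fun t ht => ?_) (x + h)
      ⟨by linarith, le_rfl⟩
    · have e : g (x + h) s - Complex.exp (Complex.I * k * h) * g x s =
          Complex.exp (Complex.I * k * (x + h : ℝ)) *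
            (Complex.exp (-(Complex.I * k) * (x + h : ℝ)) * g (x + h) s -
              Complex.exp (-(Complex.I * k) * x) * g x s) := by
        rw [mul_sub, ← mul_assoc, ← mul_assoc, ← Complex.exp_add, ← Complex.exp_add]
        have e1 : Complex.I * k * (x + h : ℝ) + -(Complex.I * k) * (x + h : ℝ) = 0 := by ring
        have e2 : Complex.I * k * (x + h : ℝ) + -(Complex.I * k) * x = Complex.I * k * h := by
          push_cast; ring
        rw [e1, e2, Complex.exp_zero, one_mul]
      rw [e, norm_mul, hunit, one_mul]
      refine this.trans (le_of_eq ?_)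
      ring
    · have he : HasDerivAt (fun t : ℝ => Complex.exp (-(Complex.I * k) * t))
          (Complex.exp (-(Complex.I * k) * t) * -(Complex.I * k)) t := by
        have := ((hasDerivAt_id t).ofReal_comp.const_mul (-(Complex.I * k))).cexp
        simpa using this
      have := (he.mul (hg.deriv₁ t (lt_of_lt_of_le hxL ht.1) s hs)).hasDerivWithinAt
        (s := Icc x (x + h))
      convert! this using 1
      ring
    · have e : -(Complex.I * k) * (t : ℂ) = Complex.I * k * ((-t : ℝ) : ℂ) := by push_cast; ring
      rw [norm_mul, e, hunit, one_mul]
      exact hR t (lt_of_lt_of_le hxR ht.1) (lt_of_lt_of_le hxL ht.1) s hs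
  have i1 := (hg.continuousOn_section_mul (γ := γ) n (x := x + h)
    (by linarith)).intervalIntegrable_of_Icc (μ := MeasureTheory.volume) (by norm_num)
  have i2 := (hg.continuousOn_section_mul (γ := γ) n (x := x)
    hxL.le).intervalIntegrable_of_Icc (μ := MeasureTheory.volume) (by norm_num)
  rw [← intervalIntegral.integral_const_mul, ← intervalIntegral.integral_sub i1 (i2.const_mul _)]
  have hbound : ‖∫ s in (-1 : ℝ)..0, (g (x + h) s * (rawMode k γ n s : ℂ) -
      Complex.exp (Complex.I * k * h) * (g x s * (rawMode k γ n s : ℂ)))‖ ≤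
      c * h * E * |0 - (-1 : ℝ)| := by
    -- The pointwise bound is known only in the open strip; `s = 0` is a null set.
    refine intervalIntegral.norm_integral_le_of_norm_le_const_ae ?_
    have h0 : ∀ᵐ s : ℝ, s ≠ 0 := by simp [MeasureTheory.ae_iff]
    filter_upwards [h0] with s hs0 hs
    rw [uIoc_of_le (by norm_num)] at hs
    have hs' : s ∈ Ioo (-1 : ℝ) 0 := ⟨hs.1, lt_of_le_of_ne hs.2 hs0⟩
    rw [← mul_assoc, ← sub_mul, norm_mul]
    refine mul_le_mul (hpt s hs') ?_ (norm_nonneg _) (by positivity)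
    rw [Complex.norm_real]
    exact abs_rawMode_le k γ n (Ioo_subset_Icc_self hs')
  refine hbound.trans_lt ?_
  have : c * h * E * |0 - (-1 : ℝ)| = η * (h / (2 * (h + 1))) := by
    rw [hc]; norm_num; field_simp
  rw [this]
  refine mul_lt_of_lt_one_right hη ?_
  rw [div_lt_one (by positivity)]
  linarith

theorem continuousOn_modal (hg : OutgoingWave ν k L g g₁ g₁₁ g₂ g₂₂) (n : ℕ) :
    ContinuousOn (fun x => ∫ s in (-1 : ℝ)..0, g x s * (rawMode k γ n s : ℂ)) (Ici L) := by
  -- Clamping both variables extends `g` continuously to the whole plane.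
  have hc : Continuous fun q : ℝ × ℝ => g (max L q.1) (max (-1) (min 0 q.2)) := by
    refine hg.cont.comp_continuous
      (f := fun q : ℝ × ℝ => (max L q.1, max (-1) (min 0 q.2))) (by fun_prop) fun q => ?_
    exact ⟨mem_Ici.2 (le_max_left _ _), le_max_left _ _, max_le (by norm_num) (min_le_left _ _)⟩
  have hu : Continuous fun s => (rawMode k γ n s : ℂ) :=
    Complex.continuous_ofReal.comp (continuous_rawMode k γ n)
  have := intervalIntegral.continuous_parametric_intervalIntegral_of_continuous' (a₀ := -1)
    (μ := MeasureTheory.volume)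
    (f := fun x s => g (max L x) (max (-1) (min 0 s)) * (rawMode k γ n s : ℂ))
    (hc.mul (hu.comp continuous_snd)) 0
  refine this.continuousOn.congr fun x hx => ?_
  refine intervalIntegral.integral_congr fun s hs => ?_
  rw [uIcc_of_le (by norm_num)] at hs
  simp only [max_eq_right (mem_Ici.1 hx), min_eq_right hs.2, max_eq_right hs.1]

/-- Every modal coefficient of an outgoing wave propagates by its longitudinal factor. -/
theorem modal_shift (hg : OutgoingWave ν k L g g₁ g₁₁ g₂ g₂₂) (hd : Dispersion ν k γ) (n : ℕ)
    {x : ℝ} (hx : L ≤ x) :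
    ∫ s in (-1 : ℝ)..0, g x s * (rawMode k γ n s : ℂ) =
      longitudinal k γ n (x - L) * ∫ s in (-1 : ℝ)..0, g L s * (rawMode k γ n s : ℂ) := by
  set A : ℝ → ℂ := fun x => ∫ s in (-1 : ℝ)..0, g x s * (rawMode k γ n s : ℂ) with hA
  rcases hx.eq_or_lt with rfl | hx'
  · simp [longitudinal_eq]
  set h := x - L with hh
  have hpos : 0 < h := sub_pos.2 hx'
  have interior : ∀ y > L, A (y + h) = Complex.exp (-rate k γ n * h) * A y := by
    intro y hy
    -- Sampling along `y + jh`. For `n = 0`, `exp(-q) = ω`; for `n ≥ 1`, `|exp q| > 1 = |ω|`.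
    have := eq_of_dAlembert_recurrence (a := fun j => A (y + j * h)) (q := rate k γ n * h)
      (ω := Complex.exp (Complex.I * k * h)) ?_ (fun j => ?_) ?_ ?_
    · simpa using this
    · rw [Complex.norm_exp, Real.one_le_exp_iff]
      cases n with
      | zero => simp [rate]
      | succ n =>
        have := hd.γ_pos (n := n + 1) (by omega)
        simp [rate]
        positivity
    · have hj : 0 ≤ j * h := by positivity
      have := hg.dAlembert hd n (x := y + (j + 1 : ℕ) * h) hpos.le (by push_cast; linarith)
      have e1 : y + (j + 1 : ℕ) * h + h = y + (j + 2 : ℕ) * h := by push_cast; ring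
      have e2 : y + (j + 1 : ℕ) * h - h = y + j * h := by push_cast; ring
      rw [e1, e2] at this
      exact this
    · have ht : Tendsto (fun j : ℕ => y + j * h) atTop atTop :=
        tendsto_atTop_add_const_left _ _ (tendsto_natCast_atTop_atTop.atTop_mul_const hpos)
      refine ((hg.tendsto_modal_shift (γ := γ) n hpos.le).comp ht).congr fun j => ?_
      have e1 : y + (j + 1 : ℕ) * h = y + j * h + h := by push_cast; ring
      simp only [Function.comp_apply, hA, e1]
    · cases n with
      | zero => left; simp [rate]
      | succ n =>
        right
        intro he
        have h1 := congrArg norm he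
        have h2 := hd.γ_pos (n := n + 1) (by omega)
        rw [Complex.norm_exp, Complex.norm_exp] at h1
        simp [rate] at h1
        rcases h1 with h1 | h1 <;> linarith
  -- The equations hold only for `x > L`, so the base point `L` is reached by letting `y` decrease
  -- to it.
  have hcA : ContinuousOn A (Ici L) := hg.continuousOn_modal n
  have l1 : Tendsto (fun y => A (y + h)) (𝓝[>] L) (𝓝 (A (L + h))) := by
    refine (hcA (L + h) (by simp [hpos.le])).tendsto.comp (tendsto_nhdsWithin_iff.2 ⟨?_, ?_⟩)
    · exact ((continuous_add_const h).tendsto L).mono_left nhdsWithin_le_nhds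
    · filter_upwards [self_mem_nhdsWithin] with y hy
      simp only [mem_Ioi, mem_Ici] at hy ⊢
      linarith
  have l2 : Tendsto (fun y => Complex.exp (-rate k γ n * h) * A y) (𝓝[>] L)
      (𝓝 (Complex.exp (-rate k γ n * h) * A L)) :=
    ((hcA L self_mem_Ici).mono_left (nhdsWithin_mono _ Ioi_subset_Ici_self)).const_mul _
  have heq : A (L + h) = Complex.exp (-rate k γ n * h) * A L := by
    refine tendsto_nhds_unique l1 (l2.congr' ?_)
    filter_upwards [self_mem_nhdsWithin] with y hy
    exact (interior y hy).symm
  have hxh : L + h = x := by rw [hh]; ring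
  rw [hxh] at heq
  change A x = _ * A L
  rw [heq, longitudinal_eq, hh]
  push_cast
  rfl

end OutgoingWave

/-! ### Solutions of the water-wave problem are outgoing waves in both ends of the strip -/

namespace Geometry

variable (G : Geometry) {L₁ : ℝ}

theorem notMem_closure_obstacle (hobs : ∀ x ∈ closure G.Ωo, |x 0| < L₁) {x : Plane}
    (hx : L₁ ≤ |x 0|) : x ∉ closure G.Ωo := fun h => (hobs x h).not_ge hx

theorem mem_Ω_iff (hL₁ : G.L₀ < L₁) (hobs : ∀ x ∈ closure G.Ωo, |x 0| < L₁) {x : Plane}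
    (hx : L₁ ≤ |x 0|) : x ∈ G.Ω ↔ -1 < x 1 ∧ x 1 < 0 := by
  rw [← G.flat x (hL₁.trans_le hx)]
  exact ⟨fun h => h.1, fun h => ⟨h, G.notMem_closure_obstacle hobs hx⟩⟩

theorem continuous_vertical (a : ℝ) : Continuous fun s : ℝ => (!₂[a, s] : Plane) := by
  fun_prop

theorem mem_closure_Ω (hL₁ : G.L₀ < L₁) (hobs : ∀ x ∈ closure G.Ωo, |x 0| < L₁) {a s : ℝ}
    (ha : L₁ ≤ |a|) (hs : s ∈ Icc (-1 : ℝ) 0) : (!₂[a, s] : Plane) ∈ closure G.Ω := by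
  have hmap : MapsTo (fun s : ℝ => (!₂[a, s] : Plane)) (Ioo (-1) 0) G.Ω := fun s hs =>
    (G.mem_Ω_iff hL₁ hobs (by simpa using ha)).2 (by simpa using hs)
  refine hmap.closure (continuous_vertical a) ?_
  rwa [closure_Ioo (by norm_num)]

theorem eventually_far {L : ℝ} {x : Plane} (hx : L < |x 0|) : ∀ᶠ y : Plane in 𝓝 x, L < |y 0| := by
  have : Continuous fun y : Plane => |y 0| := by fun_prop
  exact this.continuousAt.eventually_const_lt hx

theorem mem_Γf (hobs : ∀ x ∈ closure G.Ωo, |x 0| < L₁) {a : ℝ} (ha : L₁ ≤ |a|) :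
    (!₂[a, 0] : Plane) ∈ G.Γf :=
  ⟨by simp, G.notMem_closure_obstacle hobs (by simpa using ha)⟩

theorem mem_Γb (hL₁ : G.L₀ < L₁) (hobs : ∀ x ∈ closure G.Ωo, |x 0| < L₁) {a : ℝ}
    (ha : L₁ ≤ |a|) : (!₂[a, -1] : Plane) ∈ G.Γb := by
  refine ⟨?_, by simp⟩
  rw [frontier, G.isOpen_fluid.interior_eq]
  refine ⟨closure_mono sdiff_subset (G.mem_closure_Ω hL₁ hobs ha (by norm_num)), fun h => ?_⟩
  have := (G.flat _ (by simpa using hL₁.trans_le ha)).1 h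
  simp at this

/-- An affine function of the depth defines the domain near both flat parts of the boundary. -/
theorem isInwardUnitNormal_of_affine {Ω : Set Plane} {x : Plane} {σ c : ℝ} (hσ : |σ| = 1)
    (hx : σ * x 1 + c = 0) (hΩ : ∀ᶠ y in 𝓝 x, (y ∈ Ω ↔ 0 < σ * y 1 + c)) :
    IsInwardUnitNormal Ω x !₂[0, σ] := by
  refine ⟨?_, fun y => σ * y 1 + c, by fun_prop, hx, ⟨1, one_pos, ?_⟩, hΩ⟩
  · rw [EuclideanSpace.norm_eq]
    simpa using eq_or_eq_neg_of_abs_eq hσ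
  · rw [one_smul]
    refine HasGradientAt.gradient ?_
    rw [hasGradientAt_iff_hasFDerivAt]
    have h1 : HasFDerivAt (fun y : Plane => y 1) (EuclideanSpace.proj (𝕜 := ℝ) (1 : Fin 2)) x :=
      (EuclideanSpace.proj (𝕜 := ℝ) (1 : Fin 2)).hasFDerivAt
    have h2 := (h1.const_mul σ).add_const c
    convert! h2 using 1
    ext y
    simp [PiLp.inner_apply, mul_comm]

theorem surface_normal (hL₁ : G.L₀ < L₁) (hobs : ∀ x ∈ closure G.Ωo, |x 0| < L₁) {a : ℝ}
    (ha : L₁ < |a|) : IsInwardUnitNormal G.Ω !₂[a, 0] !₂[0, -1] := by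
  refine isInwardUnitNormal_of_affine (c := 0) (by simp) (by simp) ?_
  have h1 : ∀ᶠ y : Plane in 𝓝 !₂[a, 0], -1 < y 1 := by
    have : Continuous fun y : Plane => y 1 := by fun_prop
    exact this.continuousAt.eventually_const_lt (by simp)
  filter_upwards [h1, eventually_far (x := !₂[a, 0]) (by simpa using ha)] with y hy hy'
  rw [G.mem_Ω_iff hL₁ hobs hy'.le]
  constructor
  · intro h; linarith [h.2]
  · intro h; exact ⟨hy, by linarith⟩

theorem bottom_normal (hL₁ : G.L₀ < L₁) (hobs : ∀ x ∈ closure G.Ωo, |x 0| < L₁) {a : ℝ}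
    (ha : L₁ < |a|) : IsInwardUnitNormal G.Ω !₂[a, -1] !₂[0, 1] := by
  refine isInwardUnitNormal_of_affine (c := 1) (by simp) (by simp) ?_
  have h1 : ∀ᶠ y : Plane in 𝓝 !₂[a, -1], y 1 < 0 := by
    have : Continuous fun y : Plane => y 1 := by fun_prop
    exact this.continuousAt.eventually_lt_const (by simp)
  filter_upwards [h1, eventually_far (x := !₂[a, -1]) (by simpa using ha)] with y hy hy'
  rw [G.mem_Ω_iff hL₁ hobs hy'.le]
  constructor
  · intro h; linarith [h.1]
  · intro h; exact ⟨by linarith, hy⟩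

end Geometry

/-- The point at signed distance `σ x` and height `s`. -/
def pt (σ x s : ℝ) : Plane := !₂[σ * x, s]

theorem pt_eq (σ x s : ℝ) :
    pt σ x s = x • (σ • (!₂[1, 0] : Plane)) + s • (!₂[0, 1] : Plane) := by
  ext i; fin_cases i <;> simp [pt, mul_comm]

theorem continuous_pt (σ : ℝ) : Continuous fun q : ℝ × ℝ => pt σ q.1 q.2 := by
  simp only [pt_eq]; fun_prop

theorem hasDerivAt_pt_left (σ x s : ℝ) :
    HasDerivAt (fun x => pt σ x s) (σ • (!₂[1, 0] : Plane)) x := by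
  simp only [pt_eq]
  simpa using ((hasDerivAt_id x).smul_const (σ • (!₂[1, 0] : Plane))).add_const
    (s • (!₂[0, 1] : Plane))

theorem hasDerivAt_pt_right (σ x s : ℝ) :
    HasDerivAt (fun s => pt σ x s) (!₂[0, 1] : Plane) s := by
  simp only [pt_eq]
  simpa using ((hasDerivAt_id s).smul_const (!₂[0, 1] : Plane)).const_add
    (x • (σ • (!₂[1, 0] : Plane)))

theorem laplacian_plane {φ : Plane → ℂ} (x : Plane) :
    Laplacian.laplacian φ x = fderiv ℝ (fderiv ℝ φ) x !₂[1, 0] !₂[1, 0] +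
      fderiv ℝ (fderiv ℝ φ) x !₂[0, 1] !₂[0, 1] := by
  have h0 : EuclideanSpace.single (0 : Fin 2) (1 : ℝ) = !₂[1, 0] := by
    ext i; fin_cases i <;> simp
  have h1 : EuclideanSpace.single (1 : Fin 2) (1 : ℝ) = !₂[0, 1] := by
    ext i; fin_cases i <;> simp
  rw [InnerProductSpace.laplacian_eq_iteratedFDeriv_orthonormalBasis φ
    (EuclideanSpace.basisFun (Fin 2) ℝ)]
  simp [iteratedFDeriv_two_apply, h0, h1]

/-- The sign `σ` treats both ends at once: `σ² = 1` preserves Laplace's equation, and reflection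
turns the radiation condition at `-∞` into the one at `+∞`. -/
theorem IsSolution.outgoingWave {G : Geometry} {ν k : ℝ} {f₁ f₂ φ : Plane → ℂ}
    (hφ : IsSolution G ν k f₁ f₂ φ) {L₁ L₂ L : ℝ} (hL₁ : G.L₀ < L₁)
    (hobs : ∀ x ∈ closure G.Ωo, |x 0| < L₁)
    (hf₁ : ∀ x ∈ G.Γf, L₂ < |x 0| → f₁ x = 0)
    (hf₂ : ∀ x : Plane, L₂ < |x 0| → x 1 = -1 → f₂ x = 0) (hLL₁ : L₁ ≤ L) (hLL₂ : L₂ ≤ L)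
    {σ : ℝ} (hσ : σ = 1 ∨ σ = -1) :
    OutgoingWave ν k L (fun x s => φ (pt σ x s))
      (fun x s => σ * fderiv ℝ φ (pt σ x s) !₂[1, 0])
      (fun x s => fderiv ℝ (fderiv ℝ φ) (pt σ x s) !₂[1, 0] !₂[1, 0])
      (fun x s => fderiv ℝ φ (pt σ x s) !₂[0, 1])
      (fun x s => fderiv ℝ (fderiv ℝ φ) (pt σ x s) !₂[0, 1] !₂[0, 1]) := by
  have hσ1 : |σ| = 1 := by rcases hσ with rfl | rfl <;> simp
  have hσσ : σ * σ = 1 := by rcases hσ with rfl | rfl <;> simp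
  have hL0 : 0 < L := G.L₀_pos.trans (hL₁.trans_le hLL₁)
  have habs : ∀ x, L ≤ x → |σ * x| = x := fun x hx => by
    rw [abs_mul, hσ1, one_mul, abs_of_pos (hL0.trans_le hx)]
  have hΩ : ∀ x ≥ L, ∀ s, pt σ x s ∈ G.Ω ↔ s ∈ Ioo (-1 : ℝ) 0 := fun x hx s => by
    rw [G.mem_Ω_iff hL₁ hobs (by simpa [pt, habs x hx] using hLL₁.trans hx)]
    simp [pt]
  have hcd : ∀ x > L, ∀ s ∈ Ioo (-1 : ℝ) 0, ContDiffAt ℝ 2 φ (pt σ x s) := fun x hx s hs =>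
    (hφ.harmonic _ ((hΩ x hx.le s).2 hs)).1
  have hd1 : ∀ x > L, ∀ s ∈ Ioo (-1 : ℝ) 0, HasFDerivAt φ (fderiv ℝ φ (pt σ x s)) (pt σ x s) :=
    fun x hx s hs => ((hcd x hx s hs).differentiableAt (by norm_num)).hasFDerivAt
  have hcd' : ∀ x > L, ∀ s ∈ Ioo (-1 : ℝ) 0, ContDiffAt ℝ 1 (fderiv ℝ φ) (pt σ x s) :=
    fun x hx s hs => (hcd x hx s hs).fderiv_right (by norm_num)
  have hd2 : ∀ x > L, ∀ s ∈ Ioo (-1 : ℝ) 0,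
      HasFDerivAt (fderiv ℝ φ) (fderiv ℝ (fderiv ℝ φ) (pt σ x s)) (pt σ x s) :=
    fun x hx s hs => ((hcd' x hx s hs).differentiableAt (by norm_num)).hasFDerivAt
  have hcd'' : ∀ x > L, ∀ s ∈ Ioo (-1 : ℝ) 0,
      ContinuousAt (fderiv ℝ (fderiv ℝ φ)) (pt σ x s) :=
    fun x hx s hs => ((hcd' x hx s hs).fderiv_right (m := 0) (by norm_num)).continuousAt
  have hptc := continuous_pt σ
  have hboundary : ∀ x s : ℝ, Tendsto (fun q : ℝ × ℝ => pt σ q.1 q.2)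
      (𝓝[Ioi L ×ˢ Ioo (-1) 0] (x, s)) (𝓝[G.Ω] (pt σ x s)) := fun x s => by
    refine tendsto_nhdsWithin_iff.2 ⟨(hptc.tendsto (x, s)).mono_left nhdsWithin_le_nhds, ?_⟩
    filter_upwards [self_mem_nhdsWithin] with q hq
    exact (hΩ q.1 (le_of_lt hq.1) q.2).2 hq.2
  refine ⟨?_, ?_, ?_, ?_, ?_, ?_, ?_, ?_, ?_, ?_, ?_⟩
  · refine hφ.continuousOn.comp hptc.continuousOn fun q hq => ?_
    refine G.mem_closure_Ω hL₁ hobs ?_ hq.2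
    rw [habs _ hq.1]
    exact hLL₁.trans hq.1
  · intro q hq
    refine ContinuousAt.continuousWithinAt (continuousAt_const.mul ?_)
    exact ((hcd' q.1 hq.1 q.2 hq.2).continuousAt.comp (f := fun q : ℝ × ℝ => pt σ q.1 q.2)
      hptc.continuousAt).clm_apply continuousAt_const
  · intro q hq
    refine ContinuousAt.continuousWithinAt ?_
    exact (((hcd'' q.1 hq.1 q.2 hq.2).comp (f := fun q : ℝ × ℝ => pt σ q.1 q.2)
      hptc.continuousAt).clm_apply continuousAt_const).clm_apply continuousAt_const
  · intro x hx s hs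
    have := (hd1 x hx s hs).comp_hasDerivAt x (hasDerivAt_pt_left σ x s)
    simpa using! this
  · intro x hx s hs
    have := (hd2 x hx s hs).comp_hasDerivAt x (hasDerivAt_pt_left σ x s)
    have h2 := (this.clm_apply (hasDerivAt_const x (!₂[1, 0] : Plane))).const_mul (σ : ℂ)
    convert! h2 using 1
    simp only [map_smul, map_zero, add_zero, smul_apply, Complex.real_smul]
    rw [← mul_assoc, ← Complex.ofReal_mul, hσσ, Complex.ofReal_one, one_mul]
  · intro x hx s hs
    exact (hd1 x hx s hs).comp_hasDerivAt s (hasDerivAt_pt_right σ x s)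
  · intro x hx s hs
    have := (hd2 x hx s hs).comp_hasDerivAt s (hasDerivAt_pt_right σ x s)
    have h2 := this.clm_apply (hasDerivAt_const s (!₂[0, 1] : Plane))
    simpa using! h2
  · intro x hx s hs
    rw [← laplacian_plane]
    exact (hφ.harmonic _ ((hΩ x hx.le s).2 hs)).2.self_of_nhds
  · intro x hx
    have hx' : L < |σ * x| := by rwa [habs x hx.le]
    have hmem : pt σ x 0 ∈ G.Γf := G.mem_Γf hobs (hLL₁.trans hx'.le)
    have h0 := hf₁ _ hmem (by simpa [pt] using hLL₂.trans_lt hx')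
    have h1 := (hφ.free_surface _ hmem _
      (G.surface_normal hL₁ hobs (hLL₁.trans_lt hx'))).comp (hboundary x 0)
    rw [h0] at h1
    -- The inward normal at the surface points down, so the vertical derivative tends to `+ν φ`.
    have h2 := h1.neg
    have e : (!₂[0, -1] : Plane) = -!₂[0, 1] := by ext i; fin_cases i <;> simp
    simpa [e, Function.comp_def] using h2
  · intro x hx
    have hx' : L < |σ * x| := by rwa [habs x hx.le]
    have hmem : pt σ x (-1) ∈ G.Γb := G.mem_Γb hL₁ hobs (hLL₁.trans hx'.le)
    have h0 := hf₂ (pt σ x (-1)) (by simpa [pt] using hLL₂.trans_lt hx') (by simp [pt])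
    have h1 := (hφ.solid _ (Or.inl hmem) _
      (G.bottom_normal hL₁ hobs (hLL₁.trans_lt hx'))).comp (hboundary x (-1))
    rw [h0] at h1
    exact h1
  · intro η hη
    rcases hσ with rfl | rfl
    · have h1 := (NormedAddGroup.tendsto_nhds_zero.1 hφ.radiation_right) η hη
      rw [eventually_inf_principal, eventually_comap] at h1
      obtain ⟨R, hR⟩ := eventually_atTop.1 h1
      refine ⟨R, fun x hxR hxL s hs => ?_⟩
      have := hR x hxR.le (pt 1 x s) (by simp [pt]) ((hΩ x hxL.le s).2 hs)
      simpa using this.le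
    · have h1 := (NormedAddGroup.tendsto_nhds_zero.1 hφ.radiation_left) η hη
      rw [eventually_inf_principal, eventually_comap] at h1
      obtain ⟨R, hR⟩ := eventually_atBot.1 h1
      refine ⟨-R, fun x hxR hxL s hs => ?_⟩
      have := hR (-x) (by linarith) (pt (-1) x s) (by simp [pt]) ((hΩ x hxL.le s).2 hs)
      rw [← norm_neg]
      refine le_trans (le_of_eq ?_) this.le
      congr 1
      push_cast
      ring

/-! ### Modal series -/

/-- The open right half-plane. -/
def rightHalfPlane : Set ℂ := {w | 0 < w.re}

theorem isOpen_rightHalfPlane : IsOpen rightHalfPlane :=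
  isOpen_lt continuous_const Complex.continuous_re

/-- The Dirichlet-type series with coefficients `a` in the longitudinal factors. -/
def longitudinalSeries (k : ℝ) (γ : ℕ → ℝ) (a : ℕ → ℂ) (w : ℂ) : ℂ :=
  ∑' n, a n * longitudinal k γ n w

/-- The modal series `∑ aₙ rawModeₙ(s) longitudinalₙ(w)`, summed by d'Alembert's formula. -/
def modalSeries (k : ℝ) (γ : ℕ → ℝ) (a : ℕ → ℂ) (w : ℂ) (s : ℝ) : ℂ :=
  1 / 2 * (longitudinalSeries k γ a (w + Complex.I * (s + 1)) +
    longitudinalSeries k γ a (w + -Complex.I * (s + 1)))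

/-- The partial sums of the modal series. -/
def modalSum (k : ℝ) (γ : ℕ → ℝ) (a : ℕ → ℂ) (N : ℕ) (w : ℂ) (s : ℝ) : ℂ :=
  ∑ n ∈ Finset.range (N + 1), a n * rawMode k γ n s * longitudinal k γ n w

theorem norm_longitudinal_zero (k : ℝ) (γ : ℕ → ℝ) (w : ℂ) :
    ‖longitudinal k γ 0 w‖ = Real.exp (-k * w.im) := by
  simp [longitudinal, Complex.norm_exp]

theorem norm_longitudinal_succ (k : ℝ) (γ : ℕ → ℝ) (n : ℕ) (w : ℂ) :
    ‖longitudinal k γ (n + 1) w‖ = Real.exp (-γ (n + 1) * w.re) := by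
  simp [longitudinal, Complex.norm_exp]

theorem differentiable_longitudinal (k : ℝ) (γ : ℕ → ℝ) (n : ℕ) :
    Differentiable ℂ (longitudinal k γ n) := by
  have : longitudinal k γ n = fun w => Complex.exp (-rate k γ n * w) :=
    funext (longitudinal_eq k γ n)
  rw [this]
  fun_prop

/-- Euler's formula for the cosine. The wavenumber `ik` and the rate `-ik` of the mode `0` differ by
a sign, which evenness absorbs. -/
theorem rawMode_mul_longitudinal (k : ℝ) (γ : ℕ → ℝ) (n : ℕ) (w : ℂ) (s : ℝ) :
    (rawMode k γ n s : ℂ) * longitudinal k γ n w = 1 / 2 *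
      (longitudinal k γ n (w + Complex.I * (s + 1)) +
        longitudinal k γ n (w + -Complex.I * (s + 1))) := by
  have h : Complex.cos (wavenumber k γ n * (s + 1)) = Complex.cos (rate k γ n * (s + 1)) := by
    cases n with
    | zero =>
      rw [← Complex.cos_neg]
      simp only [wavenumber, rate]
      ring_nf
    | succ n => rfl
  rw [rawMode_eq_cos, h]
  simp only [longitudinal_eq, Complex.cos]
  rw [div_mul_eq_mul_div, add_mul, ← Complex.exp_add, ← Complex.exp_add]
  ring_nf

theorem modalSum_eq (k : ℝ) (γ : ℕ → ℝ) (a : ℕ → ℂ) (N : ℕ) (w : ℂ) (s : ℝ) :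
    modalSum k γ a N w s = 1 / 2 *
      (∑ n ∈ Finset.range (N + 1), a n * longitudinal k γ n (w + Complex.I * (s + 1)) +
        ∑ n ∈ Finset.range (N + 1), a n * longitudinal k γ n (w + -Complex.I * (s + 1))) := by
  rw [← Finset.sum_add_distrib, Finset.mul_sum]
  refine Finset.sum_congr rfl fun n _ => ?_
  rw [mul_assoc, rawMode_mul_longitudinal]
  ring

namespace Dispersion

variable {ν k : ℝ} {γ : ℕ → ℝ} {a : ℕ → ℂ} {M : ℝ}

/-- Weierstrass test: bounded coefficients and `γ n ≥ n` give a geometric majorant of ratio `exp(-Re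
w₀ / 2)`. The neighbourhood also bounds `Im w` below because the mode `0` has size `exp(-k Im w)`.
-/
theorem tendsto_longitudinalSeries (hd : Dispersion ν k γ) (ha : ∀ n, ‖a n‖ ≤ M) :
    TendstoLocallyUniformlyOn
      (fun N w => ∑ n ∈ Finset.range (N + 1), a n * longitudinal k γ n w)
      (longitudinalSeries k γ a) atTop rightHalfPlane := by
  have hM : 0 ≤ M := (norm_nonneg _).trans (ha 0)
  refine tendstoLocallyUniformlyOn_of_forall_exists_nhds fun w₀ hw₀ => ?_
  have hw₀' : 0 < w₀.re := hw₀
  refine ⟨{w | w₀.re / 2 < w.re ∧ -(|w₀.im| + 1) < w.im}, mem_nhdsWithin_of_mem_nhds ?_, ?_⟩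
  · refine IsOpen.mem_nhds ((isOpen_lt continuous_const Complex.continuous_re).inter
      (isOpen_lt continuous_const Complex.continuous_im)) ⟨?_, ?_⟩
    · linarith
    · linarith [neg_abs_le w₀.im]
  · set r := Real.exp (-(w₀.re / 2)) with hr
    have hr1 : r < 1 := Real.exp_lt_one_iff.2 (by linarith)
    have hsum : Summable fun n : ℕ => M * Real.exp (k * (|w₀.im| + 1)) * r ^ n :=
      (summable_geometric_of_lt_one (Real.exp_pos _).le hr1).mul_left _
    have := tendstoUniformlyOn_tsum_nat hsum
      (s := {w : ℂ | w₀.re / 2 < w.re ∧ -(|w₀.im| + 1) < w.im})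
      (f := fun n w => a n * longitudinal k γ n w) (fun n w hw => ?_)
    · exact fun v hv => (tendsto_add_atTop_nat 1).eventually (this v hv)
    · rw [norm_mul, mul_assoc]
      refine mul_le_mul (ha n) ?_ (norm_nonneg _) hM
      cases n with
      | zero =>
        rw [norm_longitudinal_zero, pow_zero, mul_one]
        refine Real.exp_le_exp.2 ?_
        nlinarith [hd.k_pos, hw.2]
      | succ n =>
        rw [norm_longitudinal_succ, hr, ← Real.exp_nat_mul, ← Real.exp_add]
        refine Real.exp_le_exp.2 ?_
        have h1 := hd.natCast_le_γ (n := n + 1) (by omega)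
        have h2 := hd.k_pos
        have h3 : 0 ≤ k * (|w₀.im| + 1) := by positivity
        have h4 : ((n + 1 : ℕ) : ℝ) * (w₀.re / 2) ≤ γ (n + 1) * w.re :=
          mul_le_mul h1 hw.1.le (by linarith) (le_trans (Nat.cast_nonneg _) h1)
        linarith

theorem differentiableOn_longitudinalSeries (hd : Dispersion ν k γ) (ha : ∀ n, ‖a n‖ ≤ M) :
    DifferentiableOn ℂ (longitudinalSeries k γ a) rightHalfPlane :=
  (hd.tendsto_longitudinalSeries ha).differentiableOn (Eventually.of_forall fun _ =>
    (Differentiable.fun_sum fun n _ =>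
      (differentiable_longitudinal k γ n).const_mul (a n)).differentiableOn) isOpen_rightHalfPlane

/-- The shifts `± i(s+1)` leave `Re w` unchanged, so convergence holds for every real `s`, end
points of the depth interval included. -/
theorem tendsto_modalSeries (hd : Dispersion ν k γ) (ha : ∀ n, ‖a n‖ ≤ M) :
    TendstoLocallyUniformlyOn (fun N (q : ℂ × ℝ) => modalSum k γ a N q.1 q.2)
      (fun q => modalSeries k γ a q.1 q.2) atTop (rightHalfPlane ×ˢ univ) := by
  have hE := hd.tendsto_longitudinalSeries ha
  have h1 := hE.comp (t := rightHalfPlane ×ˢ univ)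
    (fun q : ℂ × ℝ => q.1 + Complex.I * (q.2 + 1))
    (fun q hq => by simpa [rightHalfPlane] using hq.1) (by fun_prop)
  have h2 := hE.comp (t := rightHalfPlane ×ˢ univ)
    (fun q : ℂ × ℝ => q.1 + -Complex.I * (q.2 + 1))
    (fun q hq => by simpa [rightHalfPlane] using hq.1) (by fun_prop)
  have h3 := (uniformContinuous_const_smul (1 / 2 : ℂ)).comp_tendstoLocallyUniformlyOn (h1.add h2)
  refine h3.congr fun N q _ => ?_
  simp only [Function.comp_apply, Pi.add_apply, smul_eq_mul]
  rw [modalSum_eq]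

/-- The modal series, pulled back by `z ↦ σ z - L`, is smooth and satisfies Laplace's equation. -/
theorem laplace_modalSeries (hd : Dispersion ν k γ) (ha : ∀ n, ‖a n‖ ≤ M) {σ : ℂ}
    (hσ : σ ^ 2 = 1) {L z : ℂ} (hz : σ * z - L ∈ rightHalfPlane) :
    ContDiff ℝ 2 (modalSeries k γ a (σ * z - L)) ∧ ∀ s : ℝ,
      iteratedDeriv 2 (fun z => modalSeries k γ a (σ * z - L) s) z +
        iteratedDeriv 2 (modalSeries k γ a (σ * z - L)) s = 0 := by
  set E := longitudinalSeries k γ a with hE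
  have hEd : DifferentiableOn ℂ E rightHalfPlane := hd.differentiableOn_longitudinalSeries ha
  have hE1 : ∀ w ∈ rightHalfPlane, HasDerivAt E (deriv E w) w := fun w hw =>
    (hEd.differentiableAt (isOpen_rightHalfPlane.mem_nhds hw)).hasDerivAt
  have hE2 : ∀ w ∈ rightHalfPlane, HasDerivAt (deriv E) (deriv (deriv E) w) w := fun w hw =>
    ((hEd.deriv isOpen_rightHalfPlane).differentiableAt
      (isOpen_rightHalfPlane.mem_nhds hw)).hasDerivAt
  have hmem : ∀ (w : ℂ) (s : ℝ) (j : ℂ), w ∈ rightHalfPlane → j = Complex.I ∨ j = -Complex.I →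
      w + j * (s + 1) ∈ rightHalfPlane := by
    rintro w s j hw (rfl | rfl) <;> simpa [rightHalfPlane] using hw
  have dz : ∀ (F : ℂ → ℂ) (F' : ℂ → ℂ), (∀ w ∈ rightHalfPlane, HasDerivAt F (F' w) w) →
      ∀ (j : ℂ), j = Complex.I ∨ j = -Complex.I → ∀ (s : ℝ) (z : ℂ), σ * z - L ∈ rightHalfPlane →
      HasDerivAt (fun z => F (σ * z - L + j * (s + 1))) (F' (σ * z - L + j * (s + 1)) * σ) z := by
    intro F F' hF j hj s z hz
    have h1 : HasDerivAt (fun z : ℂ => σ * z - L + j * (s + 1)) σ z := by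
      simpa using (((hasDerivAt_id z).const_mul σ).sub_const L).add_const (j * ((s : ℂ) + 1))
    exact (hF _ (hmem _ s j hz hj)).comp z h1
  have ds : ∀ (F : ℂ → ℂ) (F' : ℂ → ℂ), (∀ w ∈ rightHalfPlane, HasDerivAt F (F' w) w) →
      ∀ (j : ℂ), j = Complex.I ∨ j = -Complex.I → ∀ (s : ℝ),
      HasDerivAt (fun s : ℝ => F (σ * z - L + j * (s + 1)))
        (F' (σ * z - L + j * (s + 1)) * j) s := by
    intro F F' hF j hj s
    have h1 : HasDerivAt (fun s : ℝ => σ * z - L + j * ((s : ℂ) + 1)) j s := by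
      simpa using (((hasDerivAt_id s).ofReal_comp.add_const (1 : ℂ)).const_mul j).const_add (σ * z - L)
    exact (hF _ (hmem _ s j hz hj)).comp s h1
  have hI : Complex.I = Complex.I ∨ Complex.I = -Complex.I := Or.inl rfl
  have hI' : -Complex.I = Complex.I ∨ -Complex.I = -Complex.I := Or.inr rfl
  have hs1 : ∀ s : ℝ, HasDerivAt (modalSeries k γ a (σ * z - L)) (1 / 2 *
      (deriv E (σ * z - L + Complex.I * (s + 1)) * Complex.I +
        deriv E (σ * z - L + -Complex.I * (s + 1)) * -Complex.I)) s := fun s =>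
    ((ds E _ hE1 _ hI s).add (ds E _ hE1 _ hI' s)).const_mul _
  have hs2 : ∀ s : ℝ, HasDerivAt (fun s : ℝ => 1 / 2 *
      (deriv E (σ * z - L + Complex.I * (s + 1)) * Complex.I +
        deriv E (σ * z - L + -Complex.I * (s + 1)) * -Complex.I)) (1 / 2 *
      (deriv (deriv E) (σ * z - L + Complex.I * (s + 1)) * Complex.I * Complex.I +
        deriv (deriv E) (σ * z - L + -Complex.I * (s + 1)) * -Complex.I * -Complex.I)) s :=
    fun s => (((ds _ _ hE2 _ hI s).mul_const _).add ((ds _ _ hE2 _ hI' s).mul_const _)).const_mul _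
  have hds : deriv (modalSeries k γ a (σ * z - L)) = fun s : ℝ => 1 / 2 *
      (deriv E (σ * z - L + Complex.I * (s + 1)) * Complex.I +
        deriv E (σ * z - L + -Complex.I * (s + 1)) * -Complex.I) := funext fun s => (hs1 s).deriv
  have hEc : ContDiffOn ℂ 2 E rightHalfPlane := hEd.contDiffOn isOpen_rightHalfPlane
  have hcd : ∀ j : ℂ, j = Complex.I ∨ j = -Complex.I →
      ContDiff ℝ 2 fun s : ℝ => E (σ * z - L + j * ((s : ℂ) + 1)) := by
    intro j hj
    refine contDiff_iff_contDiffAt.2 fun s => ?_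
    have h1 : ContDiffAt ℝ 2 E (σ * z - L + j * ((s : ℂ) + 1)) :=
      (hEc.contDiffAt (isOpen_rightHalfPlane.mem_nhds (hmem _ s j hz hj))).restrict_scalars ℝ
    have h2 : ContDiff ℝ 2 fun s : ℝ => σ * z - L + j * ((s : ℂ) + 1) :=
      contDiff_const.add (contDiff_const.mul (Complex.ofRealCLM.contDiff.add contDiff_const))
    exact h1.comp s h2.contDiffAt
  refine ⟨contDiff_const.mul ((hcd _ hI).add (hcd _ hI')), fun s => ?_⟩
  have hopen : ∀ᶠ y in 𝓝 z, σ * y - L ∈ rightHalfPlane := by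
    have : Continuous fun y => σ * y - L := by fun_prop
    exact this.continuousAt.eventually (isOpen_rightHalfPlane.mem_nhds hz)
  have hz1 : deriv (fun z => modalSeries k γ a (σ * z - L) s) =ᶠ[𝓝 z] fun z => 1 / 2 *
      (deriv E (σ * z - L + Complex.I * (s + 1)) * σ +
        deriv E (σ * z - L + -Complex.I * (s + 1)) * σ) := by
    filter_upwards [hopen] with y hy
    exact (((dz E _ hE1 _ hI s y hy).add (dz E _ hE1 _ hI' s y hy)).const_mul _).deriv
  have hz2 : HasDerivAt (fun z => 1 / 2 *
      (deriv E (σ * z - L + Complex.I * (s + 1)) * σ +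
        deriv E (σ * z - L + -Complex.I * (s + 1)) * σ)) (1 / 2 *
      (deriv (deriv E) (σ * z - L + Complex.I * (s + 1)) * σ * σ +
        deriv (deriv E) (σ * z - L + -Complex.I * (s + 1)) * σ * σ)) z :=
    (((dz _ _ hE2 _ hI s z hz).mul_const _).add ((dz _ _ hE2 _ hI' s z hz).mul_const _)).const_mul _
  rw [iteratedDeriv_succ, iteratedDeriv_one, iteratedDeriv_succ, iteratedDeriv_one, hz1.deriv_eq,
    hz2.deriv, hds, (hs2 s).deriv]
  -- Each second derivative falls on `E''`, with factor `σ² = 1` in `z` and `(±i)² = -1` in `s`.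
  linear_combination (1 / 2 * (deriv (deriv E) (σ * z - L + Complex.I * (s + 1)) +
        deriv (deriv E) (σ * z - L + -Complex.I * (s + 1)))) * (hσ + Complex.I_sq)

theorem differentiableOn_modalSeries (hd : Dispersion ν k γ) (ha : ∀ n, ‖a n‖ ≤ M) (s : ℝ) :
    DifferentiableOn ℂ (fun w => modalSeries k γ a w s) rightHalfPlane := by
  have hE := hd.differentiableOn_longitudinalSeries ha
  have h1 : DifferentiableOn ℂ (fun w => longitudinalSeries k γ a (w + Complex.I * (s + 1)))
      rightHalfPlane :=
    hE.comp (by fun_prop) fun w hw => by simpa [rightHalfPlane] using hw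
  have h2 : DifferentiableOn ℂ (fun w => longitudinalSeries k γ a (w + -Complex.I * (s + 1)))
      rightHalfPlane :=
    hE.comp (by fun_prop) fun w hw => by simpa [rightHalfPlane] using hw
  exact (h1.add h2).const_mul _

/-- The windows give a gap above `nπ - π/2`. The crude offset `2` costs only a factor `exp(2δ)` in
the decay estimate. -/
theorem γ_gap (hd : Dispersion ν k γ) (n : ℕ) : (n : ℝ) - 2 ≤ γ (n + 1) - γ 1 := by
  have h1 := (hd.γ_eq (n + 1) (by omega)).2.1
  have h2 := (hd.γ_eq 1 le_rfl).2.2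
  push_cast at h1 h2
  nlinarith [Real.pi_gt_three, Real.pi_lt_four, Nat.cast_nonneg (α := ℝ) n]

/-- Away from the end of the strip, the modal series decays like its slowest terms. -/
theorem exists_norm_modalSeries_le (hd : Dispersion ν k γ) (ha : ∀ n, ‖a n‖ ≤ M) {δ : ℝ}
    (hδ : 0 < δ) : ∃ K, 0 ≤ K ∧ ∀ w : ℂ, δ ≤ w.re → ∀ s ∈ Icc (-1 : ℝ) 0,
      ‖modalSeries k γ a w s‖ ≤ K * (Real.exp (-k * w.im) + Real.exp (-γ 1 * w.re)) := by
  have hM : 0 ≤ M := (norm_nonneg _).trans (ha 0)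
  set r := Real.exp (-δ) with hr
  have hr0 : 0 < r := Real.exp_pos _
  have hr1 : r < 1 := Real.exp_lt_one_iff.2 (by linarith)
  have hgeo := summable_geometric_of_lt_one hr0.le hr1
  set C := M * Real.cosh k with hC
  have hC0 : 0 ≤ C := mul_nonneg hM (Real.cosh_pos k).le
  set S := ∑' n : ℕ, r ^ n with hS
  have hS0 : 0 ≤ S := tsum_nonneg fun n => pow_nonneg hr0.le n
  refine ⟨C + C * Real.exp (2 * δ) * S, by positivity, fun w hw s hs => ?_⟩
  have hcoef : ∀ n, ‖a n * rawMode k γ n s‖ ≤ C := fun n => by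
    rw [norm_mul, Complex.norm_real]
    exact mul_le_mul (ha n) (abs_rawMode_le k γ n hs) (norm_nonneg _) hM
  have hlim := ((hd.tendsto_modalSeries ha).tendsto_at (a := (w, s))
    ⟨lt_of_lt_of_le hδ hw, mem_univ _⟩).norm
  refine le_of_tendsto hlim (Eventually.of_forall fun N => ?_)
  have h0 : ‖a 0 * rawMode k γ 0 s * longitudinal k γ 0 w‖ ≤ C * Real.exp (-k * w.im) := by
    rw [norm_mul, norm_longitudinal_zero]
    exact mul_le_mul_of_nonneg_right (hcoef 0) (Real.exp_pos _).le
  -- With `Re w ≥ δ`, the excess `(γ (n+1) - γ 1) Re w` is at least `(n - 2) δ`, which leaves a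
  -- geometric series.
  have hn : ∀ n : ℕ, ‖a (n + 1) * rawMode k γ (n + 1) s * longitudinal k γ (n + 1) w‖ ≤
      C * Real.exp (2 * δ) * Real.exp (-γ 1 * w.re) * r ^ n := fun n => by
    rw [norm_mul, norm_longitudinal_succ, mul_assoc, mul_assoc]
    refine mul_le_mul (hcoef _) ?_ (Real.exp_pos _).le hC0
    rw [hr, ← Real.exp_nat_mul, ← Real.exp_add, ← Real.exp_add]
    refine Real.exp_le_exp.2 ?_
    have h1 := hd.γ_gap n
    have h2 : 0 ≤ γ (n + 1) - γ 1 := sub_nonneg.2 (hd.γ_mono.monotone (Nat.zero_le n))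
    nlinarith [mul_le_mul_of_nonneg_left hw h2, mul_le_mul_of_nonneg_right h1 hδ.le]
  have hsum : ‖modalSum k γ a N w s‖ ≤ C * Real.exp (-k * w.im) +
      C * Real.exp (2 * δ) * Real.exp (-γ 1 * w.re) * S := by
    rw [modalSum, Finset.sum_range_succ', add_comm]
    refine (norm_add_le _ _).trans (add_le_add h0 ?_)
    refine (norm_sum_le_of_le _ fun n _ => hn n).trans ?_
    rw [← Finset.mul_sum]
    exact mul_le_mul_of_nonneg_left (hgeo.sum_le_tsum _ fun n _ => pow_nonneg hr0.le n)
      (by positivity)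
  refine hsum.trans ?_
  have e1 := Real.exp_pos (-k * w.im)
  have e2 := Real.exp_pos (-γ 1 * w.re)
  have e3 : 0 ≤ C * Real.exp (2 * δ) * S := by positivity
  nlinarith [mul_nonneg hC0 e2.le, mul_nonneg e3 e1.le]

end Dispersion

/-! ### Modal expansion of outgoing waves -/

namespace OutgoingWave

variable {ν k L : ℝ} {γ : ℕ → ℝ} {g g₁ g₁₁ g₂ g₂₂ : ℝ → ℝ → ℂ}

/-- The coefficients of a function with respect to the raw modes. -/
def modalCoeff (k : ℝ) (γ : ℕ → ℝ) (f : ℝ → ℂ) (n : ℕ) : ℂ :=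
  (∫ s in (-1 : ℝ)..0, f s * (rawMode k γ n s : ℂ)) /
    ((∫ s in (-1 : ℝ)..0, rawMode k γ n s ^ 2 : ℝ) : ℂ)

theorem exists_norm_modalCoeff_le (hd : Dispersion ν k γ) {f : ℝ → ℂ}
    (hf : ContinuousOn f (Icc (-1) 0)) : ∃ M, ∀ n, ‖modalCoeff k γ f n‖ ≤ M := by
  obtain ⟨B, hB⟩ := isCompact_Icc.exists_bound_of_continuousOn hf
  have hB0 : 0 ≤ B := (norm_nonneg _).trans (hB 0 (by norm_num))
  refine ⟨B * Real.cosh k / (1 / 4), fun n => ?_⟩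
  have h1 := hd.quarter_le_integral_rawMode_sq n
  rw [modalCoeff, norm_div, Complex.norm_real,
    Real.norm_of_nonneg (le_trans (by norm_num) h1)]
  refine div_le_div₀ (mul_nonneg hB0 (Real.cosh_pos k).le) ?_ (by norm_num) h1
  have := intervalIntegral.norm_integral_le_of_norm_le_const (a := (-1 : ℝ)) (b := 0)
    (f := fun s => f s * (rawMode k γ n s : ℂ)) (C := B * Real.cosh k) fun s hs => by
      rw [uIoc_of_le (by norm_num)] at hs
      have hs' := Ioc_subset_Icc_self hs
      rw [norm_mul, Complex.norm_real]
      exact mul_le_mul (hB s hs') (abs_rawMode_le k γ n hs') (norm_nonneg _) hB0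
  simpa using this

theorem integral_modalSum_mul (hd : Dispersion ν k γ) (a : ℕ → ℂ) (w : ℂ) {N m : ℕ} (hm : m ≤ N) :
    ∫ s in (-1 : ℝ)..0, modalSum k γ a N w s * (rawMode k γ m s : ℂ) =
      a m * longitudinal k γ m w * ((∫ s in (-1 : ℝ)..0, rawMode k γ m s ^ 2 : ℝ) : ℂ) := by
  have hpt : ∀ s : ℝ, modalSum k γ a N w s * (rawMode k γ m s : ℂ) =
      ∑ n ∈ Finset.range (N + 1), a n * longitudinal k γ n w *
        ((rawMode k γ n s * rawMode k γ m s : ℝ) : ℂ) := fun s => by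
    rw [modalSum, Finset.sum_mul]
    refine Finset.sum_congr rfl fun n _ => ?_
    push_cast; ring
  simp_rw [hpt]
  have hint : ∀ n ∈ Finset.range (N + 1), IntervalIntegrable (fun s => a n * longitudinal k γ n w *
      ((rawMode k γ n s * rawMode k γ m s : ℝ) : ℂ)) MeasureTheory.volume (-1) 0 := fun n _ =>
    (continuous_const.mul (Complex.continuous_ofReal.comp ((continuous_rawMode k γ n).mul
      (continuous_rawMode k γ m)))).intervalIntegrable _ _
  rw [intervalIntegral.integral_finsetSum hint]
  rw [Finset.sum_eq_single m]
  · rw [intervalIntegral.integral_const_mul, intervalIntegral.integral_ofReal]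
    simp_rw [sq]
  · intro n _ hn
    rw [intervalIntegral.integral_const_mul, intervalIntegral.integral_ofReal,
      hd.integral_rawMode_mul hn]
    simp
  · intro h
    exact absurd (Finset.mem_range.2 (by omega)) h

/-- An outgoing wave is the sum of its modal series. -/
theorem eq_modalSeries (hg : OutgoingWave ν k L g g₁ g₁₁ g₂ g₂₂) (hd : Dispersion ν k γ)
    {x : ℝ} (hx : L < x) {s : ℝ} (hs : s ∈ Icc (-1 : ℝ) 0) :
    g x s = modalSeries k γ (modalCoeff k γ (g L)) (x - L) s := by
  set a := modalCoeff k γ (g L) with ha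
  obtain ⟨M, hM⟩ := exists_norm_modalCoeff_le hd (hg.continuousOn_section le_rfl)
  have hw : ((x : ℂ) - L) ∈ rightHalfPlane := by simpa [rightHalfPlane] using hx
  have hserC : ContinuousOn (modalSeries k γ a (x - L)) (Icc (-1) 0) := by
    have := (hd.laplace_modalSeries hM (σ := 1) (L := L) (z := x) (by norm_num)
      (by simpa using hw)).1.continuous
    simp only [one_mul] at this
    exact this.continuousOn
  rw [← sub_eq_zero]
  refine hd.eq_zero_of_orthogonal (h := fun s => g x s - modalSeries k γ a (x - L) s)
    ((hg.continuousOn_section hx.le).sub hserC) (fun m => ?_) hs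
  have hu : Continuous fun s => (rawMode k γ m s : ℂ) :=
    Complex.continuous_ofReal.comp (continuous_rawMode k γ m)
  have i1 := (hg.continuousOn_section_mul (γ := γ) m hx.le).intervalIntegrable_of_Icc
    (μ := MeasureTheory.volume) (by norm_num)
  have i2 : IntervalIntegrable (fun s => modalSeries k γ a (x - L) s * (rawMode k γ m s : ℂ))
      MeasureTheory.volume (-1) 0 :=
    (hserC.mul hu.continuousOn).intervalIntegrable_of_Icc (by norm_num)
  simp_rw [sub_mul]
  rw [intervalIntegral.integral_sub i1 i2, sub_eq_zero, hg.modal_shift hd m hx.le]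
  have hsumC : ∀ N, Continuous fun s => modalSum k γ a N (x - L) s := fun N =>
    continuous_finsetSum _ fun n _ => (continuous_const.mul
      (Complex.continuous_ofReal.comp (continuous_rawMode k γ n))).mul continuous_const
  -- Uniform convergence in the depth allows termwise integration; by orthogonality the projection
  -- is constant once `N ≥ m`.
  have hlu : TendstoUniformlyOn (fun N s => modalSum k γ a N (x - L) s * (rawMode k γ m s : ℂ))
      (fun s => modalSeries k γ a (x - L) s * (rawMode k γ m s : ℂ)) atTop (uIcc (-1) 0) := by
    rw [uIcc_of_le (by norm_num), ← tendstoLocallyUniformlyOn_iff_tendstoUniformlyOn_of_compact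
      isCompact_Icc]
    have h1 := (hd.tendsto_modalSeries hM).comp (t := Icc (-1 : ℝ) 0)
      (fun s : ℝ => ((x : ℂ) - L, s)) (fun s _ => ⟨hw, mem_univ _⟩) (by fun_prop)
    have h2 : TendstoLocallyUniformlyOn (fun (_ : ℕ) s => (rawMode k γ m s : ℂ))
        (fun s => (rawMode k γ m s : ℂ)) atTop (Icc (-1 : ℝ) 0) :=
      fun v hv s _ => ⟨univ, univ_mem, Eventually.of_forall fun _ _ _ => refl_mem_uniformity hv⟩
    exact h1.mul₀ h2 hserC hu.continuousOn
  have hcont : ∀ N, Continuous fun s => modalSum k γ a N (x - L) s * (rawMode k γ m s : ℂ) :=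
    fun N => (hsumC N).mul hu
  have hl := hlu.tendsto_intervalIntegral_of_continuousOn (μ := MeasureTheory.volume)
    (Eventually.of_forall fun N => (hcont N).continuousOn)
  refine tendsto_nhds_unique (tendsto_const_nhds.congr' ?_) hl
  filter_upwards [eventually_ge_atTop m] with N hN
  rw [integral_modalSum_mul hd a _ hN, ha, modalCoeff]
  have hne : ((∫ s in (-1 : ℝ)..0, rawMode k γ m s ^ 2 : ℝ) : ℂ) ≠ 0 := by
    have := hd.quarter_le_integral_rawMode_sq m
    exact_mod_cast (by linarith : (0 : ℝ) < ∫ s in (-1 : ℝ)..0, rawMode k γ m s ^ 2).ne'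
  field_simp

end OutgoingWave

/-! ### Stretching paths -/

/-- Mean value inequality on each piece, glued by continuity: induction on the number of exceptional
points, splitting at one of them. -/
theorem mul_sub_le_of_deriv_ge {f : ℝ → ℝ} (hf : Continuous f) {c : ℝ} {S : Set ℝ} {a b : ℝ}
    (hab : a ≤ b) (hS : (S ∩ Ioo a b).Finite)
    (hd : ∀ x ∉ S, DifferentiableAt ℝ f x ∧ c ≤ deriv f x) : c * (b - a) ≤ f b - f a := by
  induction hn : (S ∩ Ioo a b).ncard using Nat.strong_induction_on generalizing a b with
  | _ n ih =>
    rcases (S ∩ Ioo a b).eq_empty_or_nonempty with he | ⟨p, hpS, hp⟩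
    · have hnot : ∀ x ∈ Ioo a b, x ∉ S := fun x hx hxS => by
        have : x ∈ S ∩ Ioo a b := ⟨hxS, hx⟩
        rw [he] at this
        exact this
      refine (convex_Icc a b).mul_sub_le_image_sub_of_le_deriv hf.continuousOn ?_ ?_ a
        (left_mem_Icc.2 hab) b (right_mem_Icc.2 hab) hab
      · rw [interior_Icc]
        exact fun x hx => (hd x (hnot x hx)).1.differentiableWithinAt
      · rw [interior_Icc]
        exact fun x hx => (hd x (hnot x hx)).2
    · have hlt : ∀ T : Set ℝ, T ⊆ S ∩ Ioo a b → p ∉ T → T.ncard < n := fun T hT hpT => by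
        rw [← hn]
        exact ncard_lt_ncard ⟨hT, fun h => hpT (h ⟨hpS, hp⟩)⟩ hS
      have s1 : S ∩ Ioo a p ⊆ S ∩ Ioo a b :=
        inter_subset_inter_right _ (Ioo_subset_Ioo_right hp.2.le)
      have s2 : S ∩ Ioo p b ⊆ S ∩ Ioo a b :=
        inter_subset_inter_right _ (Ioo_subset_Ioo_left hp.1.le)
      have h1 := ih _ (hlt _ s1 fun h => lt_irrefl _ h.2.2) hp.1.le (hS.subset s1) rfl
      have h2 := ih _ (hlt _ s2 fun h => lt_irrefl _ h.2.1) hp.2.le (hS.subset s2) rfl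
      linarith

namespace IsStretchingPath

variable {L c C : ℝ} {τ : ℝ → ℂ}

theorem mul_sub_le (hτ : IsStretchingPath L c C τ) {a b : ℝ} (hab : a ≤ b) :
    c * (b - a) ≤ (τ b).re - (τ a).re := by
  obtain ⟨S, hS, hd⟩ := hτ.piecewise
  refine mul_sub_le_of_deriv_ge (f := fun x => (τ x).re) (S := S)
    (Complex.continuous_re.comp hτ.continuous) hab ?_ fun x hx => ?_
  · refine (hS (max |a| |b|)).subset (inter_subset_inter_right _ fun x hx => ⟨?_, ?_⟩)
    · have := neg_abs_le a
      linarith [le_max_left |a| |b|, hx.1]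
    · have := le_abs_self b
      linarith [le_max_right |a| |b|, hx.2]
  · obtain ⟨h1, h2, -⟩ := hd x hx
    have : HasDerivAt (fun x => (τ x).re) (deriv τ x).re x :=
      Complex.reCLM.hasFDerivAt.comp_hasDerivAt x h1.hasDerivAt
    exact ⟨this.differentiableAt, by rw [this.deriv]; exact h2.le⟩

/-- Continuity adds the end points `±L`, from which the growth of `Re τ` is measured. -/
theorem eq_self_of_abs_le (hτ : IsStretchingPath L c C τ) (hL : 0 < L) {x : ℝ} (hx : |x| ≤ L) :
    τ x = x := by
  have h1 : EqOn τ (fun x => (x : ℂ)) (Ioo (-L) L) := fun x hx => hτ.eq_self x (abs_lt.2 hx)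
  have h2 := h1.closure hτ.continuous Complex.continuous_ofReal
  rw [closure_Ioo (by linarith)] at h2
  exact h2 (abs_le.1 hx)

theorem le_re (hτ : IsStretchingPath L c C τ) (hL : 0 < L) {x : ℝ} (hx : L ≤ x) :
    L + c * (x - L) ≤ (τ x).re := by
  have h1 := hτ.mul_sub_le hx
  rw [hτ.eq_self_of_abs_le hL (abs_of_pos hL).le, Complex.ofReal_re] at h1
  linarith

theorem re_le (hτ : IsStretchingPath L c C τ) (hL : 0 < L) {x : ℝ} (hx : x ≤ -L) :
    (τ x).re ≤ -(L + c * (-x - L)) := by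
  have h1 := hτ.mul_sub_le hx
  rw [hτ.eq_self_of_abs_le hL (by rw [abs_neg, abs_of_pos hL]), Complex.ofReal_re] at h1
  linarith

theorem abs_re_ge (hτ : IsStretchingPath L c C τ) (hL : 0 < L) {x : ℝ} (hx : L ≤ |x|) :
    L + c * (|x| - L) ≤ |(τ x).re| := by
  rcases le_abs.1 hx with h | h
  · rw [abs_of_pos (hL.trans_le h)]
    exact (hτ.le_re hL h).trans (le_abs_self _)
  · rw [abs_of_neg (by linarith : x < 0)]
    exact le_trans (by linarith [hτ.re_le hL (by linarith : x ≤ -L)]) (neg_le_abs _)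

end IsStretchingPath

/-! ### The holomorphic extension -/

open OutgoingWave

/-- The sum of the modal expansions in both ends, with coefficients `a` (right) and `b` (left). -/
def extension (k : ℝ) (γ : ℕ → ℝ) (L : ℝ) (a b : ℕ → ℂ) (z : ℂ) (s : ℝ) : ℂ :=
  if 0 < z.re then modalSeries k γ a (z - L) s else modalSeries k γ b (-1 * z - L) s

section extension

variable {ν k L : ℝ} {γ : ℕ → ℝ} {a b : ℕ → ℂ}

theorem extension_right (hL : 0 < L) {z : ℂ} (hz : L < z.re) :
    extension k γ L a b z = modalSeries k γ a (1 * z - L) := by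
  funext s
  simp [extension, hL.trans hz]

theorem extension_left (hL : 0 < L) {z : ℂ} (hz : z.re < -L) :
    extension k γ L a b z = modalSeries k γ b (-1 * z - L) := by
  funext s
  rw [extension, if_neg (by linarith)]

theorem isOpen_right (L : ℝ) : IsOpen {z : ℂ | L < z.re} :=
  isOpen_lt continuous_const Complex.continuous_re

theorem isOpen_left (L : ℝ) : IsOpen {z : ℂ | z.re < -L} :=
  isOpen_lt Complex.continuous_re continuous_const

/-- Near every point of `{|Re z| > L}` the extension is one of the two modal series. -/
theorem exists_extension_eventuallyEq (hL : 0 < L) {z : ℂ} (hz : L < |z.re|) :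
    ∃ σ : ℂ, ∃ d : ℕ → ℂ, σ ^ 2 = 1 ∧ (d = a ∨ d = b) ∧ σ * z - L ∈ rightHalfPlane ∧
      ∀ᶠ y in 𝓝 z, extension k γ L a b y = modalSeries k γ d (σ * y - L) := by
  rcases lt_abs.1 hz with h | h
  · refine ⟨1, a, by norm_num, Or.inl rfl, by simpa [rightHalfPlane] using h, ?_⟩
    filter_upwards [(isOpen_right L).mem_nhds h] with y hy
    exact extension_right hL hy
  · refine ⟨-1, b, by norm_num, Or.inr rfl, by simp [rightHalfPlane]; linarith, ?_⟩
    filter_upwards [(isOpen_left L).mem_nhds (show z.re < -L by linarith)] with y hy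
    exact extension_left hL hy

variable {M : ℝ}

theorem Dispersion.differentiableOn_extension (hd : Dispersion ν k γ) (hL : 0 < L)
    (ha : ∀ n, ‖a n‖ ≤ M) (hb : ∀ n, ‖b n‖ ≤ M) (s : ℝ) :
    DifferentiableOn ℂ (fun z => extension k γ L a b z s) {z : ℂ | L < |z.re|} := by
  intro z hz
  obtain ⟨σ, d, -, hdd, hmem, hev⟩ := exists_extension_eventuallyEq (k := k) (γ := γ) (a := a)
    (b := b) hL hz
  have hdM : ∀ n, ‖d n‖ ≤ M := by rcases hdd with rfl | rfl <;> assumption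
  have h1 : DifferentiableAt ℂ (fun z => modalSeries k γ d (σ * z - L) s) z :=
    ((hd.differentiableOn_modalSeries hdM s).differentiableAt
      (isOpen_rightHalfPlane.mem_nhds hmem)).comp z (f := fun z => σ * z - L) (by fun_prop)
  refine (h1.congr_of_eventuallyEq ?_).differentiableWithinAt
  filter_upwards [hev] with y hy
  rw [hy]

theorem Dispersion.laplace_extension (hd : Dispersion ν k γ) (hL : 0 < L)
    (ha : ∀ n, ‖a n‖ ≤ M) (hb : ∀ n, ‖b n‖ ≤ M) {z : ℂ} (hz : L < |z.re|) :
    ContDiffOn ℝ 2 (extension k γ L a b z) (Icc (-1) 0) ∧ ∀ s ∈ Icc (-1 : ℝ) 0,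
      iteratedDeriv 2 (fun w => extension k γ L a b w s) z +
        iteratedDerivWithin 2 (extension k γ L a b z) (Icc (-1) 0) s = 0 := by
  obtain ⟨σ, d, hσ, hdd, hmem, hev⟩ := exists_extension_eventuallyEq (k := k) (γ := γ) (a := a)
    (b := b) hL hz
  have hdM : ∀ n, ‖d n‖ ≤ M := by rcases hdd with rfl | rfl <;> assumption
  obtain ⟨h1, h2⟩ := hd.laplace_modalSeries hdM hσ hmem
  rw [hev.self_of_nhds]
  refine ⟨h1.contDiffOn, fun s hs => ?_⟩
  rw [iteratedDerivWithin_eq_iteratedDeriv (uniqueDiffOn_Icc (by norm_num)) h1.contDiffAt hs,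
    ← h2 s]
  congr 1
  refine Filter.EventuallyEq.iteratedDeriv_eq 2 ?_
  filter_upwards [hev] with y hy
  rw [hy]

/-- The parameter `y` is any lower bound, possibly negative, for the outward imaginary part: `|Im
τ|` on a stretching path, `c(|x| - a)` for the linear PML. The factor `exp(γ 1 * L)` pays for
measuring `Re z` from `0` instead of `L`. -/
theorem Dispersion.exists_norm_extension_le (hd : Dispersion ν k γ) (hL : 0 < L)
    (ha : ∀ n, ‖a n‖ ≤ M) (hb : ∀ n, ‖b n‖ ≤ M) {δ : ℝ} (hδ : 0 < δ) :
    ∃ K, 0 ≤ K ∧ ∀ (z : ℂ) (y : ℝ), L + δ ≤ |z.re| → (0 < z.re → y ≤ z.im) →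
      (z.re < 0 → y ≤ -z.im) → ∀ s ∈ Icc (-1 : ℝ) 0,
      ‖extension k γ L a b z s‖ ≤ K * (Real.exp (-k * y) + Real.exp (-γ 1 * |z.re|)) := by
  obtain ⟨K₁, hK₁, h₁⟩ := hd.exists_norm_modalSeries_le ha hδ
  obtain ⟨K₂, hK₂, h₂⟩ := hd.exists_norm_modalSeries_le hb hδ
  have hγ := hd.γ_pos le_rfl
  have hk := hd.k_pos
  have hE1 : 1 ≤ Real.exp (γ 1 * L) := Real.one_le_exp (by positivity)
  have aux : ∀ K : ℝ, 0 ≤ K → K ≤ K₁ + K₂ → ∀ t y r : ℝ, y ≤ t →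
      K * (Real.exp (-k * t) + Real.exp (-γ 1 * (r - L))) ≤
        (K₁ + K₂) * Real.exp (γ 1 * L) * (Real.exp (-k * y) + Real.exp (-γ 1 * r)) := by
    intro K hK0 hK t y r hyt
    rw [mul_assoc]
    refine mul_le_mul hK ?_ (by positivity) (by positivity)
    rw [mul_add, ← Real.exp_add (γ 1 * L) (-γ 1 * r)]
    refine add_le_add ?_ (le_of_eq (by ring_nf))
    have : Real.exp (-k * t) ≤ Real.exp (-k * y) := Real.exp_le_exp.2 (by nlinarith)
    nlinarith [Real.exp_pos (-k * y)]
  refine ⟨(K₁ + K₂) * Real.exp (γ 1 * L), by positivity, fun z y hz hp hn s hs => ?_⟩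
  rcases le_abs.1 hz with h | h
  · rw [extension_right hL (by linarith), abs_of_pos (by linarith : 0 < z.re)]
    refine (h₁ (1 * z - L) (by simp; linarith) s hs).trans ?_
    have e1 : (1 * z - (L : ℂ)).re = z.re - L := by simp
    have e2 : (1 * z - (L : ℂ)).im = z.im := by simp
    rw [e1, e2]
    exact aux K₁ hK₁ (by linarith) _ _ _ (hp (by linarith))
  · rw [extension_left hL (by linarith), abs_of_neg (by linarith : z.re < 0)]
    refine (h₂ (-1 * z - L) (by simp; linarith) s hs).trans ?_
    have e1 : (-1 * z - (L : ℂ)).re = -z.re - L := by simp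
    have e2 : (-1 * z - (L : ℂ)).im = -z.im := by simp
    rw [e1, e2]
    exact aux K₂ hK₂ (by linarith) _ _ _ (hn (by linarith))

end extension

/-- A holomorphic extension from the two real half-lines is unique. -/
theorem IsHolomorphicExtension.unique {L : ℝ} {φ : Plane → ℂ} {Φ Ψ : ℂ → ℝ → ℂ}
    (hΦ : IsHolomorphicExtension L φ Φ) (hΨ : IsHolomorphicExtension L φ Ψ) {z : ℂ}
    (hz : L < |z.re|) {s : ℝ} (hs : s ∈ Icc (-1 : ℝ) 0) : Ψ z s = Φ z s := by
  obtain ⟨dΦ, eΦ⟩ := hΦ s hs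
  obtain ⟨dΨ, eΨ⟩ := hΨ s hs
  have main : ∀ (U : Set ℂ) (x₀ : ℝ), IsOpen U → Convex ℝ U → U ⊆ {z : ℂ | L < |z.re|} →
      (x₀ : ℂ) ∈ U → z ∈ U → Ψ z s = Φ z s := by
    intro U x₀ hU hc hsub hx₀ hzU
    refine ((dΨ.mono hsub).analyticOnNhd hU).eqOn_of_preconnected_of_frequently_eq
      ((dΦ.mono hsub).analyticOnNhd hU) hc.isPreconnected hx₀ ?_ hzU
    have hlim : Tendsto (fun x : ℝ => (x : ℂ)) (𝓝[≠] x₀) (𝓝[≠] (x₀ : ℂ)) := by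
      refine tendsto_nhdsWithin_iff.2 ⟨(Complex.continuous_ofReal.tendsto x₀).mono_left
        nhdsWithin_le_nhds, ?_⟩
      filter_upwards [self_mem_nhdsWithin] with x hx
      simpa using hx
    refine hlim.frequently (Eventually.frequently ?_)
    have hUx : ∀ᶠ x : ℝ in 𝓝[≠] x₀, (x : ℂ) ∈ U :=
      ((Complex.continuous_ofReal.tendsto x₀).mono_left nhdsWithin_le_nhds).eventually
        (hU.mem_nhds hx₀)
    filter_upwards [hUx] with x hx
    have hxL : L < |x| := by simpa using hsub hx
    rw [eΨ x hxL, eΦ x hxL]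
  -- The two half-planes are disjoint, so the identity theorem is applied in each, from a real point
  -- of it.
  rcases lt_abs.1 hz with h | h
  · refine main {z | L < z.re} (L + 1) (isOpen_right L) (convex_halfSpace_re_gt L)
      (fun w (hw : L < w.re) => hw.trans_le (le_abs_self w.re)) (by simp) h
  · refine main {z | z.re < -L} (-L - 1) (isOpen_left L) (convex_halfSpace_re_lt (-L))
      (fun w (hw : w.re < -L) => (lt_neg_of_lt_neg hw).trans_le (neg_le_abs w.re)) (by simp)
      (show z.re < -L by linarith)

/-- The normalizing square root occurs once in the coefficient and once in the mode, and so becomes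
the division by the squared norm in `modalCoeff`. -/
theorem coeff_mul_mode {ν k : ℝ} {γ : ℕ → ℝ} (hd : Dispersion ν k γ) (φ : Plane → ℂ) (ℓ : ℝ)
    (n : ℕ) (s : ℝ) : coeff k γ φ ℓ n * mode k γ n s =
      modalCoeff k γ (fun s => φ !₂[ℓ, s]) n * rawMode k γ n s := by
  have h := hd.quarter_le_integral_rawMode_sq n
  set I := ∫ t in (-1 : ℝ)..0, rawMode k γ n t ^ 2 with hI
  have hsq : ((Real.sqrt I : ℝ) : ℂ) * (Real.sqrt I : ℝ) = (I : ℂ) := by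
    rw [← Complex.ofReal_mul, Real.mul_self_sqrt (by linarith)]
  have hI0 : (I : ℂ) ≠ 0 := by exact_mod_cast (by linarith : (0 : ℝ) < I).ne'
  have hs0 : ((Real.sqrt I : ℝ) : ℂ) ≠ 0 := fun h => hI0 (by rw [← hsq, h, zero_mul])
  have e : ∀ s, φ !₂[ℓ, s] * (mode k γ n s : ℂ) =
      φ !₂[ℓ, s] * (rawMode k γ n s : ℂ) / (Real.sqrt I : ℝ) := fun s => by
    simp only [mode, ← hI]; push_cast; ring
  rw [coeff]
  simp_rw [e]
  rw [intervalIntegral.integral_div, modalCoeff, ← hI]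
  simp only [mode, ← hI]
  push_cast
  rw [div_mul_div_comm, hsq]
  ring

end WaterWaves

end

/-! ### Assembly of the theorem -/

theorem mainTheorem2 (G : WaterWaves.Geometry) (ν k : ℝ) (γ : ℕ → ℝ)
    (hν : 0 < ν) (hk : 0 < k) (hkν : k * Real.tanh k = ν)
    (hγ : ∀ n : ℕ, 1 ≤ n → γ n * Real.tan (γ n) = -ν ∧
      n * Real.pi - Real.pi / 2 < γ n ∧ γ n < n * Real.pi)
    (f₁ f₂ φ : WaterWaves.Plane → ℂ) (hφ : WaterWaves.IsSolution G ν k f₁ f₂ φ)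
    (L₁ L₂ L : ℝ) (hL₁ : G.L₀ < L₁) (hobs : ∀ x ∈ closure G.Ωo, |x 0| < L₁)
    (hf₁ : ∀ x ∈ G.Γf, L₂ < |x 0| → f₁ x = 0)
    (hf₂ : ∀ x : WaterWaves.Plane, L₂ < |x 0| → x 1 = -1 → f₂ x = 0)
    (hL : L = max L₁ L₂) :
    ∃ Φ : ℂ → ℝ → ℂ,
      -- `Φ` is the holomorphic extension of `φ` in the first variable
      WaterWaves.IsHolomorphicExtension L φ Φ ∧
      (∀ Ψ : ℂ → ℝ → ℂ, WaterWaves.IsHolomorphicExtension L φ Ψ →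
        ∀ z : ℂ, L < |z.re| → ∀ s ∈ Set.Icc (-1 : ℝ) 0, Ψ z s = Φ z s) ∧
      -- it is given by the modal expansion
      TendstoLocallyUniformlyOn
        (fun N (p : ℂ × ℝ) => WaterWaves.rightPartialSum k γ φ L N p.1 p.2)
        (fun p => Φ p.1 p.2) Filter.atTop ({z : ℂ | L < z.re} ×ˢ Set.Icc (-1 : ℝ) 0) ∧
      TendstoLocallyUniformlyOn
        (fun N (p : ℂ × ℝ) => WaterWaves.leftPartialSum k γ φ L N p.1 p.2)
        (fun p => Φ p.1 p.2) Filter.atTop ({z : ℂ | z.re < -L} ×ˢ Set.Icc (-1 : ℝ) 0) ∧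
      -- it satisfies the Laplace equation
      (∀ z : ℂ, L < |z.re| → ContDiffOn ℝ 2 (Φ z) (Set.Icc (-1 : ℝ) 0) ∧
        ∀ s ∈ Set.Icc (-1 : ℝ) 0,
          iteratedDeriv 2 (fun w => Φ w s) z
            + iteratedDerivWithin 2 (Φ z) (Set.Icc (-1 : ℝ) 0) s = 0) ∧
      -- decay along stretching paths
      (∀ (c C : ℝ) (τ : ℝ → ℂ), WaterWaves.IsStretchingPath L c C τ →
        (∀ x₁, L < x₁ → L < (τ x₁).re) ∧ (∀ x₁, x₁ < -L → (τ x₁).re < -L) ∧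
        (∀ δ : ℝ, 0 < δ → ∃ K : ℝ, ∀ x₁ : ℝ, L + δ ≤ |x₁| → ∀ s ∈ Set.Icc (-1 : ℝ) 0,
          ‖Φ (τ x₁) s‖ ≤
            K * (Real.exp (-k * |(τ x₁).im|) + Real.exp (-γ 1 * |(τ x₁).re|))) ∧
        (∀ β b : ℝ, 0 < β → (∀ x₁, L < |x₁| → β * |x₁| - b ≤ |(τ x₁).im|) →
          ∀ δ : ℝ, 0 < δ → ∃ K : ℝ, ∀ x₁ : ℝ, L + δ ≤ |x₁| → ∀ s ∈ Set.Icc (-1 : ℝ) 0,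
            ‖Φ (τ x₁) s‖ ≤ K * Real.exp (-min (β * k) (c * γ 1) * |x₁|))) ∧
      -- rate for the linear PML
      (∀ a c : ℝ, 0 < a → 0 < c → ∀ δ : ℝ, 0 < δ →
        ∃ K : ℝ, ∀ x₁ : ℝ, L + δ ≤ |x₁| → ∀ s ∈ Set.Icc (-1 : ℝ) 0,
          ‖Φ (WaterWaves.linearPML a c x₁) s‖ ≤ K * Real.exp (-min (c * k) (γ 1) * |x₁|)) := by
  subst hL
  set L := max L₁ L₂
  have hd : WaterWaves.Dispersion ν k γ := ⟨hν, hk, hkν, hγ⟩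
  have hLL₁ : L₁ ≤ L := le_max_left _ _
  have hLL₂ : L₂ ≤ L := le_max_right _ _
  have hL0 : 0 < L := G.L₀_pos.trans (hL₁.trans_le hLL₁)
  have hγ1 := hd.γ_pos le_rfl
  have hr := hφ.outgoingWave hL₁ hobs hf₁ hf₂ hLL₁ hLL₂ (Or.inl rfl)
  have hl := hφ.outgoingWave hL₁ hobs hf₁ hf₂ hLL₁ hLL₂ (Or.inr rfl)
  set a := WaterWaves.OutgoingWave.modalCoeff k γ (fun s => φ (WaterWaves.pt 1 L s)) with ha
  set b := WaterWaves.OutgoingWave.modalCoeff k γ (fun s => φ (WaterWaves.pt (-1) L s)) with hb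
  obtain ⟨M₁, hM₁⟩ := WaterWaves.OutgoingWave.exists_norm_modalCoeff_le hd
    (hr.continuousOn_section le_rfl)
  obtain ⟨M₂, hM₂⟩ := WaterWaves.OutgoingWave.exists_norm_modalCoeff_le hd
    (hl.continuousOn_section le_rfl)
  have haM : ∀ n, ‖a n‖ ≤ max M₁ M₂ := fun n => (hM₁ n).trans (le_max_left _ _)
  have hbM : ∀ n, ‖b n‖ ≤ max M₁ M₂ := fun n => (hM₂ n).trans (le_max_right _ _)
  have hext : WaterWaves.IsHolomorphicExtension L φ (WaterWaves.extension k γ L a b) := by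
    refine fun s hs => ⟨hd.differentiableOn_extension hL0 haM hbM s, fun x hx => ?_⟩
    rcases lt_abs.1 hx with h | h
    · rw [WaterWaves.extension_right hL0 (by simpa using h), one_mul, ha,
        ← hr.eq_modalSeries hd h hs]
      simp [WaterWaves.pt]
    · have e : (-1 : ℂ) * x - L = ((-x : ℝ) : ℂ) - L := by push_cast; ring
      rw [WaterWaves.extension_left hL0 (by simp; linarith), e, hb,
        ← hl.eq_modalSeries hd h hs]
      simp [WaterWaves.pt]
  refine ⟨WaterWaves.extension k γ L a b, hext,
    fun Ψ hΨ z hz s hs => hext.unique hΨ hz hs, ?_, ?_,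
    fun z hz => hd.laplace_extension hL0 haM hbM hz, fun c C τ hτ => ?_, fun p c hp hc δ hδ => ?_⟩
  · have h := (hd.tendsto_modalSeries haM).comp
      (t := {z : ℂ | L < z.re} ×ˢ Set.Icc (-1 : ℝ) 0) (fun q : ℂ × ℝ => (q.1 - (L : ℂ), q.2))
      (fun q hq => ⟨by simpa [WaterWaves.rightHalfPlane] using hq.1, Set.mem_univ _⟩) (by fun_prop)
    refine (h.congr fun N q _ => ?_).congr_right fun q hq => ?_
    · simp only [WaterWaves.modalSum, WaterWaves.rightPartialSum, Function.comp_apply]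
      refine Finset.sum_congr rfl fun n _ => ?_
      rw [WaterWaves.coeff_mul_mode hd]
      simp [ha, WaterWaves.pt]
    · simp only [Function.comp_apply]
      rw [WaterWaves.extension_right hL0 hq.1, one_mul]
  · have h := (hd.tendsto_modalSeries hbM).comp
      (t := {z : ℂ | z.re < -L} ×ˢ Set.Icc (-1 : ℝ) 0)
      (fun q : ℂ × ℝ => (-1 * q.1 - (L : ℂ), q.2))
      (fun q hq => ⟨by
        have : q.1.re < -L := hq.1
        simp [WaterWaves.rightHalfPlane]; linarith, Set.mem_univ _⟩) (by fun_prop)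
    refine (h.congr fun N q _ => ?_).congr_right fun q hq => ?_
    · simp only [WaterWaves.modalSum, WaterWaves.leftPartialSum, Function.comp_apply]
      refine Finset.sum_congr rfl fun n _ => ?_
      have e : (-1 : ℂ) * q.1 - L = -(q.1 + L) := by ring
      rw [WaterWaves.coeff_mul_mode hd, e]
      simp [hb, WaterWaves.pt]
    · simp only [Function.comp_apply]
      rw [WaterWaves.extension_left hL0 hq.1]
  · have hright : ∀ x₁, L < x₁ → L < (τ x₁).re := fun x hx => by
      have := hτ.le_re hL0 hx.le
      nlinarith [hτ.c_pos]
    have hleft : ∀ x₁, x₁ < -L → (τ x₁).re < -L := fun x hx => by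
      have := hτ.re_le hL0 hx.le
      nlinarith [hτ.c_pos]
    have hdecay : ∀ δ : ℝ, 0 < δ → ∃ K : ℝ, 0 ≤ K ∧ ∀ x₁ : ℝ, L + δ ≤ |x₁| →
        ∀ s ∈ Set.Icc (-1 : ℝ) 0, ‖WaterWaves.extension k γ L a b (τ x₁) s‖ ≤
          K * (Real.exp (-k * |(τ x₁).im|) + Real.exp (-γ 1 * |(τ x₁).re|)) := by
      intro δ hδ
      -- A margin `δ` in `|x₁|` becomes a margin `cδ` in `|Re τ|`.
      obtain ⟨K, hK0, hK⟩ := hd.exists_norm_extension_le hL0 haM hbM (mul_pos hτ.c_pos hδ)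
      refine ⟨K, hK0, fun x hx s hs => hK (τ x) _ ?_ (fun h => ?_) (fun h => ?_) s hs⟩
      · have := hτ.abs_re_ge hL0 (x := x) (by linarith)
        nlinarith [hτ.c_pos]
      · have hxL : L < x := by
          rcases lt_abs.1 (show L < |x| by linarith) with h' | h'
          · exact h'
          · linarith [hleft x (by linarith)]
        rw [abs_of_pos (hτ.im_pos x hxL)]
      · have hxL : x < -L := by
          rcases lt_abs.1 (show L < |x| by linarith) with h' | h'
          · linarith [hright x h']
          · linarith
        rw [abs_of_neg (hτ.im_neg x hxL)]
    refine ⟨hright, hleft, fun δ hδ => ?_, fun β r hβ hβr δ hδ => ?_⟩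
    · obtain ⟨K, -, hK⟩ := hdecay δ hδ
      exact ⟨K, hK⟩
    · obtain ⟨K, hK0, hK⟩ := hdecay δ hδ
      -- The factors absorb the constants in `|Im τ| ≥ β|x| - r` and `|Re τ| ≥ c|x| - (c - 1)L`.
      refine ⟨K * (Real.exp (k * r) + Real.exp (γ 1 * (c - 1) * L)), fun x hx s hs => ?_⟩
      refine (hK x hx s hs).trans ?_
      rw [mul_assoc]
      refine mul_le_mul_of_nonneg_left ?_ hK0
      rw [add_mul, ← Real.exp_add, ← Real.exp_add]
      have h1 := hβr x (by linarith)
      have h2 := hτ.abs_re_ge hL0 (x := x) (by linarith)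
      have m1 := mul_le_mul_of_nonneg_right (min_le_left (β * k) (c * γ 1)) (abs_nonneg x)
      have m2 := mul_le_mul_of_nonneg_right (min_le_right (β * k) (c * γ 1)) (abs_nonneg x)
      refine add_le_add (Real.exp_le_exp.2 ?_) (Real.exp_le_exp.2 ?_)
      · nlinarith
      · nlinarith
  · obtain ⟨K, hK0, hK⟩ := hd.exists_norm_extension_le hL0 haM hbM hδ
    refine ⟨K * (Real.exp (k * c * p) + 1), fun x hx s hs => ?_⟩
    have hre : (WaterWaves.linearPML p c x).re = x := by simp [WaterWaves.linearPML]
    have him : (WaterWaves.linearPML p c x).im =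
        if x ≤ -p then c * (x + p) else if x < p then 0 else c * (x - p) := by
      simp only [WaterWaves.linearPML, Complex.add_im, Complex.ofReal_im, Complex.I_mul_im,
        Complex.ofReal_re, zero_add]
    -- The start `p` need not equal `L`. Before the layer the imaginary part is `0` and the chosen
    -- lower bound is negative, so one estimate covers both regimes; `Re τ = x` gives the rate `γ 1`
    -- itself.
    have h := hK (WaterWaves.linearPML p c x) (c * (|x| - p)) (by rwa [hre]) (fun h => ?_)
      (fun h => ?_) s hs
    · refine h.trans ?_
      rw [hre, mul_assoc]
      refine mul_le_mul_of_nonneg_left ?_ hK0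
      rw [add_mul, ← Real.exp_add, one_mul]
      have m1 := mul_le_mul_of_nonneg_right (min_le_left (c * k) (γ 1)) (abs_nonneg x)
      have m2 := mul_le_mul_of_nonneg_right (min_le_right (c * k) (γ 1)) (abs_nonneg x)
      refine add_le_add (Real.exp_le_exp.2 ?_) (Real.exp_le_exp.2 ?_)
      · linarith
      · linarith
    · rw [hre] at h
      rw [him, abs_of_pos h, if_neg (by linarith)]
      split_ifs with h'
      · nlinarith
      · exact le_rfl
    · rw [hre] at h
      rw [him, abs_of_neg h]
      split_ifs with h' h''
      · linarith
      · nlinarith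
      · linarith
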